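/- **Notation.** Let $[n]=\{1,\dots,n\}$. A permutation in $S_n$ is given by its rank vector $\rho=(\rho_1,\dots,\rho_n)$, or by its descent vector $\delta=(\delta_1|\cdots|\delta_n)$, where $\delta_k$ is the position of the $k$-th largest entry of $\rho$. Its cone is $C_\rho=\{u\in\mathbb R^n : u_i\le u_j \text{ whenever } \rho_i<\rho_j\}$. *Fans and rank tests.* A fan is a finite collection of polyhedral cones in $\mathbb R^n$ that contains every face of each of its members, and in which $C\cap C'$ is a face of $C$ for any two members $C,C'$. A coarsening of the $S_n$-fan is a fan $\mathcal F$ such that each class of vectors $u\in\mathbb R^n$ with the same order relations ($<$, $=$) among their coordinates lies in a cone of $\mathcal F$. It induces the partition of $S_n$ in which $\rho,\rho'$ are in the same class if and only if $C_\rho$ and $C_{\rho'}$ lie in a common cone of $\mathcal F$. A partition of $S_n$ so induced is a convex rank test. *Walls.* Two permutations share a wall, with label the conditional independence statement $\delta_k\perp\!\!\!\perp\delta_{k+1}\mid\{\delta_1,\dots,\delta_{k-1}\}$, if their descent vectors differ by exchanging the consecutive entries $\delta_k,\delta_{k+1}$. A rank test removes a wall if the two permutations sharing it are in the same class. *Graphs.*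 Let $G$ be a graph on $[n]$, and let $\mathcal K(G)$ be the family of nonempty $K\subseteq[n]$ for which the induced subgraph $G|_K$ is connected. * The graphical model rank test $\tau_{\mathcal K(G)}$ is the partition of $S_n$ in which $\rho,\rho'$ are in the same class if and only if, for each $i\in[n]$, the number of $K\in\mathcal K(G)$ with $\max_{k\in K}\rho_k=\rho_i$ equals the number of $K\in\mathcal K(G)$ with $\max_{k\in K}\rho'_k=\rho'_i$. * The graphical model $\mathcal M^G$ is the set of statements $i\perp\!\!\!\perp j\mid C$ ($i\ne j$, $C\subseteq[n]\setminus\{i,j\}$) such that $G|_{[n]\setminus C}$ contains no path from $i$ to $j$. Its dual $(\mathcal M^G)^*$ consists of the statements $i\perp\!\!\!\perp j\mid [n]\setminus(C\cup\{i,j\})$ for $i\perp\!\!\!\perp j\mid C$ in $\mathcal M^G$. * The graphical tubing rank test $\tau^*_{\mathcal K(G)}$ is the partition of $S_n$ into the connected components of the graph whose edges are the pairs of permutations sharing a wall with label in $(\mathcal M^G)^*$. * The graph associahedron is the Minkowski sum $\Delta_G=\sum_{K\in\mathcal K(G)}\mathrm{conv}\{e_k:k\in K\}$. Its normal fan $\mathcal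 N(\Delta_G)$ consists of the cones $\{u: u\cdot y\le u\cdot x\text{ for all }x\in F,\ y\in\Delta_G\}$, for $F$ a nonempty face of $\Delta_G$. * A tube of $G$ is a member of $\mathcal K(G)$ that is not the vertex set of a connected component of $G$. Two sets $A,B$ are compatible if $A\subseteq B$, or $B\subseteq A$, or $A\cap B=\emptyset$ and no edge joins $A$ to $B$. A tubing is a set of pairwise compatible tubes; the tubings form a simplicial complex. **Theorem.** For every graph $G$ on $[n]$ the graphical model rank test, the graphical tubing rank test, the normal fan of $\Delta_G$, and the simplicial complex of tubings of $G$ are isomorphic, in the following sense. 1. $\tau_{\mathcal K(G)}$ is a convex rank test, and $\mathcal N(\Delta_G)$ is the unique coarsening of the $S_n$-fan that induces it. 2. $\tau^*_{\mathcal K(G)}$ is a convex rank test, and the unique coarsening of the $S_n$-fan that induces it is the image of $\mathcal N(\Delta_G)$ under the linear automorphism $u\mapsto -u$ of $\mathbb R^n$. On permutations, the reversal $\rho\mapsto(n+1-\rho_1,\dots,n+1-\rho_n)$ carries the classes of $\tau^*_{\mathcal K(G)}$ to those of $\tau_{\mathcal K(G)}$. 3. The sets of labels of the walls removed by $\tau_{\mathcal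 K(G)}$ and by $\tau^*_{\mathcal K(G)}$ are $\mathcal M^G$ and $(\mathcal M^G)^*$, respectively. 4. The set of cones of $\mathcal N(\Delta_G)$, ordered by inclusion, is isomorphic to the face poset of the simplicial complex of tubings of $G$ (the set of all tubings, including the empty one, ordered by inclusion). -/

import Mathlib

namespace RankTest

/-! ### Fans and the fan of the braid arrangement -/

/-- A fan in `ℝⁿ`: a finite collection of polyhedral (that is, finitely generated) cones that
contains all faces of its members, and in which any two members meet in a common face. -/
structure IsFan {n : ℕ} (F : Set (PointedCone ℝ (Fin n → ℝ))) : Prop where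
  finite : F.Finite
  polyhedral : ∀ C ∈ F, Submodule.FG C
  face_mem : ∀ C ∈ F, ∀ D : PointedCone ℝ (Fin n → ℝ), D.IsFaceOf C → D ∈ F
  inter_face : ∀ C ∈ F, ∀ D ∈ F, (C ⊓ D).IsFaceOf C

/-- Permutation equivalence of two vectors: their coordinates are ordered in the same way. -/
def PermEquivalent {n : ℕ} (u v : Fin n → ℝ) : Prop :=
  ∀ i j, (u i < u j ↔ v i < v j) ∧ (u i = u j ↔ v i = v j)

/-- A coarsening of the `Sₙ`-fan: a fan such that every permutation equivalence class is contained
in one of its cones. -/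
def IsCoarsening {n : ℕ} (F : Set (PointedCone ℝ (Fin n → ℝ))) : Prop :=
  IsFan F ∧ ∀ u : Fin n → ℝ, ∃ C ∈ F, ∀ v, PermEquivalent u v → v ∈ C

/-- The maximal cone of the `Sₙ`-fan with rank vector `ρ`, i.e. the closure of the set of all data
vectors whose coordinates are ordered as those of `ρ`. -/
def chamber {n : ℕ} (ρ : Equiv.Perm (Fin n)) : Set (Fin n → ℝ) :=
  {u | ∀ i j, ρ i < ρ j → u i ≤ u j}

/-- `F` is a coarsening of the `Sₙ`-fan and `τ` is the partition of `Sₙ` that it induces: two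
permutations are in the same class iff their maximal cones lie in a common cone of `F`.
Permutations are given by their rank vectors. So `τ` is a convex rank test if `IsFanOf F τ` for
some `F`, and a convex rank test is identified with that fan. -/
def IsFanOf {n : ℕ} (F : Set (PointedCone ℝ (Fin n → ℝ))) (τ : Setoid (Equiv.Perm (Fin n))) :
    Prop :=
  IsCoarsening F ∧
    ∀ ρ ρ', τ ρ ρ' ↔
      ∃ C ∈ F, chamber ρ ⊆ (C : Set (Fin n → ℝ)) ∧ chamber ρ' ⊆ (C : Set (Fin n → ℝ))

/-- The reversed permutation, with ranks `n + 1 - ρᵢ` (for ranks in `1, …, n`). -/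
def reverse {n : ℕ} (ρ : Equiv.Perm (Fin n)) : Equiv.Perm (Fin n) :=
  ρ.trans Fin.revPerm

/-- The image of a fan under the linear automorphism `u ↦ -u` of `ℝⁿ`. -/
def oppositeFan {n : ℕ} (F : Set (PointedCone ℝ (Fin n → ℝ))) :
    Set (PointedCone ℝ (Fin n → ℝ)) :=
  (fun C => PointedCone.map (-LinearMap.id : (Fin n → ℝ) →ₗ[ℝ] (Fin n → ℝ)) C) '' F

/-! ### Conditional independence statements and walls -/

/-- An elementary conditional independence statement `i ⫫ j | K` with `K ⊆ [n] \ {i, j}`. -/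
@[ext] structure CIStatement (n : ℕ) where
  i : Fin n
  j : Fin n
  K : Finset (Fin n)
  ne : i ≠ j
  i_notMem : i ∉ K
  j_notMem : j ∉ K

/-- The dual statement `i ⫫ j | [n] \ (K ∪ {i, j})`. -/
def CIStatement.star {n : ℕ} (s : CIStatement n) : CIStatement n where
  i := s.i
  j := s.j
  K := (insert s.i (insert s.j s.K))ᶜ
  ne := s.ne
  i_notMem := by simp
  j_notMem := by simp

/-- The dual of a set of statements, obtained by dualizing all its members. -/
def dualModel {n : ℕ} (M : Set (CIStatement n)) : Set (CIStatement n) :=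
  CIStatement.star '' M

/-- The descent vector of the permutation with rank vector `ρ`: its `k`-th entry is the position of
the `k`-th largest rank. -/
def descentVector {n : ℕ} (ρ : Equiv.Perm (Fin n)) (k : Fin n) : Fin n :=
  ρ.symm k.rev

/-- The maximal cones of `ρ` and `ρ'` share a wall labelled by `s`: for two consecutive indices
`k, l = k + 1`, the descent vectors `δ, δ'` differ by exchanging their entries at `k` and `l`, and
`s` is the statement `δₖ ⫫ δₗ | {δ₁, …, δₖ₋₁}`. -/
def ShareWall {n : ℕ} (ρ ρ' : Equiv.Perm (Fin n)) (s : CIStatement n) : Prop :=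
  ∃ k l : Fin n, (k : ℕ) + 1 = l ∧
    (∀ m, descentVector ρ' m = descentVector ρ (Equiv.swap k l m)) ∧
    s.i = descentVector ρ k ∧ s.j = descentVector ρ l ∧
    s.K = (Finset.Iio k).image (descentVector ρ)

/-- The statements labelling the walls that a rank test removes, i.e. the walls whose two sides are
in the same class. -/
def removedWalls {n : ℕ} (τ : Setoid (Equiv.Perm (Fin n))) : Set (CIStatement n) :=
  {s | ∃ ρ ρ', ShareWall ρ ρ' s ∧ τ ρ ρ'}

/-- The rank test of a set `M` of statements: its classes are the connected components of the graph
on `Sₙ` whose edges are the walls with label in `M`. -/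
def testOfModel {n : ℕ} (M : Set (CIStatement n)) : Setoid (Equiv.Perm (Fin n)) :=
  Relation.EqvGen.setoid fun ρ ρ' => ∃ s ∈ M, ShareWall ρ ρ' s

/-! ### Minkowski sums of simplices -/

open Classical in
/-- The signature of `ρ` for a set family `𝒦`: the `i`-th coordinate is the number of members `K`
of `𝒦` with `max {ρₖ : k ∈ K} = ρᵢ`. -/
noncomputable def mssSignature {n : ℕ} (𝒦 : Finset (Finset (Fin n))) (ρ : Equiv.Perm (Fin n)) :
    Fin n → ℕ :=
  fun i => (𝒦.filter fun K => IsGreatest (ρ '' (K : Set (Fin n))) (ρ i)).card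

/-- The Minkowski sum of simplices test: permutations are classified by their signature. -/
noncomputable def mssTest {n : ℕ} (𝒦 : Finset (Finset (Fin n))) : Setoid (Equiv.Perm (Fin n)) :=
  Setoid.ker (mssSignature 𝒦)

/-- The simplex spanned by the unit vectors `eₖ`, `k ∈ K`. -/
def simplex {n : ℕ} (K : Finset (Fin n)) : Set (Fin n → ℝ) :=
  convexHull ℝ ((fun k => Pi.single k (1 : ℝ)) '' (K : Set (Fin n)))

open scoped Pointwise in
/-- The Minkowski sum of the simplices of the members of `𝒦`. -/
noncomputable def mssPolytope {n : ℕ} (𝒦 : Finset (Finset (Fin n))) : Set (Fin n → ℝ) :=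
  ∑ K ∈ 𝒦, simplex K

/-- The face of `P` on which the linear functional `x ↦ u · x` is maximal. -/
def maxFace {n : ℕ} (P : Set (Fin n → ℝ)) (u : Fin n → ℝ) : Set (Fin n → ℝ) :=
  {x | x ∈ P ∧ ∀ y ∈ P, u ⬝ᵥ y ≤ u ⬝ᵥ x}

/-- The normal cone of `P` at `F`: all functionals that attain their maximum over `P` at all points
of `F`. -/
def normalCone {n : ℕ} (P F : Set (Fin n → ℝ)) : PointedCone ℝ (Fin n → ℝ) where
  carrier := {u | ∀ x ∈ F, ∀ y ∈ P, u ⬝ᵥ y ≤ u ⬝ᵥ x}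
  add_mem' := by
    intro a b ha hb x hx y hy
    rw [add_dotProduct, add_dotProduct]
    exact add_le_add (ha x hx y hy) (hb x hx y hy)
  zero_mem' := by
    intro x _ y _
    simp
  smul_mem' := by
    intro c a ha x hx y hy
    have h : (c : ℝ) * (a ⬝ᵥ y) ≤ (c : ℝ) * (a ⬝ᵥ x) :=
      mul_le_mul_of_nonneg_left (ha x hx y hy) c.2
    rw [← smul_eq_mul, ← smul_eq_mul, ← smul_dotProduct, ← smul_dotProduct] at h
    exact h

/-- The (outer) normal fan of a polytope `P`: the normal cones of the nonempty faces of `P`. -/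
def normalFan {n : ℕ} (P : Set (Fin n → ℝ)) : Set (PointedCone ℝ (Fin n → ℝ)) :=
  {C | ∃ u : Fin n → ℝ, (maxFace P u).Nonempty ∧ C = normalCone P (maxFace P u)}

/-! ### Graphs -/

open Classical in
/-- The family `𝒦(G)` of all (nonempty) vertex sets whose induced subgraph is connected. -/
noncomputable def connectedSets {n : ℕ} (G : SimpleGraph (Fin n)) : Finset (Finset (Fin n)) :=
  Finset.univ.filter fun K => (G.induce (K : Set (Fin n))).Connected

/-- The graph associahedron `Δ_G`. -/
noncomputable def graphAssociahedron {n : ℕ} (G : SimpleGraph (Fin n)) : Set (Fin n → ℝ) :=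
  mssPolytope (connectedSets G)

/-- The undirected graphical model of `G`: all `i ⫫ j | K` such that the restriction of `G` to
`[n] \ K` contains no path from `i` to `j`. -/
def graphicalModel {n : ℕ} (G : SimpleGraph (Fin n)) : Set (CIStatement n) :=
  {s | ¬ ∃ p : G.Walk s.i s.j, ∀ x ∈ p.support, x ∉ s.K}

/-- The graphical model rank test of `G`. -/
noncomputable def graphicalModelTest {n : ℕ} (G : SimpleGraph (Fin n)) :
    Setoid (Equiv.Perm (Fin n)) :=
  mssTest (connectedSets G)

/-- The graphical tubing rank test of `G`. -/
def graphicalTubingTest {n : ℕ} (G : SimpleGraph (Fin n)) : Setoid (Equiv.Perm (Fin n)) :=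
  testOfModel (dualModel (graphicalModel G))

/-- A tube of `G`: a nonempty vertex set that induces a connected subgraph and is not (the vertex
set of) a whole connected component of `G`. -/
def IsTube {n : ℕ} (G : SimpleGraph (Fin n)) (A : Finset (Fin n)) : Prop :=
  (G.induce (A : Set (Fin n))).Connected ∧
    ∀ c : G.ConnectedComponent, (A : Set (Fin n)) ≠ c.supp

/-- Compatibility of two vertex sets: they are nested, or disjoint with no edge between them. -/
def Compatible {n : ℕ} (G : SimpleGraph (Fin n)) (A B : Finset (Fin n)) : Prop :=
  A ⊆ B ∨ B ⊆ A ∨ (Disjoint A B ∧ ∀ a ∈ A, ∀ b ∈ B, ¬ G.Adj a b)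

/-- A tubing of `G`: a set of pairwise compatible tubes. -/
def IsTubing {n : ℕ} (G : SimpleGraph (Fin n)) (T : Finset (Finset (Fin n))) : Prop :=
  (∀ A ∈ T, IsTube G A) ∧ ∀ A ∈ T, ∀ B ∈ T, Compatible G A B

/-- The tubings of `G` form a simplicial complex: subsets of tubings are tubings. -/
theorem IsTubing.mono {n : ℕ} {G : SimpleGraph (Fin n)} {S T : Finset (Finset (Fin n))}
    (hT : IsTubing G T) (h : S ⊆ T) : IsTubing G S :=
  ⟨fun A hA => hT.1 A (h hA), fun A hA B hB => hT.2 A (h hA) B (h hB)⟩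

/-- The face poset (with the empty face) of the simplicial complex of all tubings of `G`, ordered
by inclusion. -/
abbrev TubingComplex {n : ℕ} (G : SimpleGraph (Fin n)) : Type :=
  {T : Finset (Finset (Fin n)) // IsTubing G T}

end RankTest

/-! Everything reduces to one preorder on vectors, `ArgmaxLE`. A linear functional is maximal on a
Minkowski sum exactly where it is maximal on each summand, and on a simplex only the vertices
matter. Hence the normal cone at the face maximizing `u` consists of the `v` with `ArgmaxLE 𝒦 u v`
(`mem_normalCone_maxFace`). The fan axioms follow from this description, and two permutations have
the same signature iff their rank vectors have the same maximizer on every member of `𝒦`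
(`mssTest_iff_argmaxLE`); so the normal fan induces the test. Uniqueness is general: a
full-dimensional cone of a coarsening is the union of the chambers of a class, and all other cones
are faces of such cones (`IsFanOf.unique`).

Crossing a wall labelled `i ⫫ j | C` changes the maximizer only on sets that avoid `C` and contain
both `i` and `j`. A connected set of this kind exists iff a path from `i` to `j` avoids `C`, so the
removed walls form the graphical model. Sorting one permutation into another by adjacent exchanges
stays inside a class, so classes are connected by removed walls
(`graphicalModelTest_eq_testOfModel`). Reversal of ranks dualizes wall labels, which carries all of
this over to the tubing test and the opposite fan.

For the face poset, `u` is encoded by the tubes on which it is smaller than at every outside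
neighbour. They form a tubing, enlarging the tubing corresponds to enlarging the cone
(`argmaxLE_iff_sublevelTubes_subset`), and each tubing arises by giving a vertex minus the number of
tubes that contain it (`sublevelTubes_tubingVector`). -/

namespace RankTest

/-! ### Finitely generated cones are intersections of half-spaces -/

/-- A pointed cone is the intersection of the half-spaces with inner normals in `s`. -/
def IsHCone {n : ℕ} (s : Finset (Fin n → ℝ)) (C : PointedCone ℝ (Fin n → ℝ)) : Prop :=
  ∀ v, v ∈ C ↔ ∀ a ∈ s, 0 ≤ a ⬝ᵥ v

/-- Fourier–Motzkin elimination: adding a ray to an intersection of finitely many half-spaces gives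
an intersection of finitely many half-spaces. -/
theorem exists_halfspaces_add_ray {n : ℕ} (s : Finset (Fin n → ℝ)) (g : Fin n → ℝ) :
    ∃ s' : Finset (Fin n → ℝ), ∀ v,
      (∀ a ∈ s', 0 ≤ a ⬝ᵥ v) ↔ ∃ t : ℝ, 0 ≤ t ∧ ∀ a ∈ s, 0 ≤ a ⬝ᵥ (v - t • g) := by
  classical
  -- In the second family both coefficients are positive and the combination vanishes on `g`: it
  -- says that a lower bound on `t` does not exceed an upper bound.
  refine ⟨s.filter (fun a => 0 ≤ a ⬝ᵥ g) ∪
    Finset.image₂ (fun a b => (a ⬝ᵥ g) • b - (b ⬝ᵥ g) • a)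
      (s.filter fun a => 0 < a ⬝ᵥ g) (s.filter fun a => a ⬝ᵥ g < 0), fun v => ⟨fun h => ?_, ?_⟩⟩
  -- The least admissible `t`: the maximum of `0` and the lower bounds imposed by the normals that
  -- are negative on `g`.
  · have hne : (insert 0 ((s.filter fun a => a ⬝ᵥ g < 0).image
        fun b => (b ⬝ᵥ v) / (b ⬝ᵥ g))).Nonempty := Finset.insert_nonempty _ _
    refine ⟨Finset.max' _ hne, Finset.le_max' _ _ (Finset.mem_insert_self _ _), fun a ha => ?_⟩
    have hmax := Finset.max'_mem _ hne
    have hle := Finset.le_max' (insert 0 ((s.filter fun a => a ⬝ᵥ g < 0).image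
        fun b => (b ⬝ᵥ v) / (b ⬝ᵥ g)))
    set t := Finset.max' _ hne
    rw [dotProduct_sub, dotProduct_smul, smul_eq_mul, sub_nonneg]
    rcases lt_trichotomy (a ⬝ᵥ g) 0 with hg | hg | hg
    · have := hle ((a ⬝ᵥ v) / (a ⬝ᵥ g)) (Finset.mem_insert_of_mem
        (Finset.mem_image_of_mem _ (Finset.mem_filter.2 ⟨ha, hg⟩)))
      rwa [div_le_iff_of_neg hg] at this
    · rw [hg, mul_zero]
      exact h a (Finset.mem_union_left _ (Finset.mem_filter.2 ⟨ha, hg.ge⟩))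
    · rcases Finset.mem_insert.1 hmax with h0 | hm
      · rw [h0, zero_mul]
        exact h a (Finset.mem_union_left _ (Finset.mem_filter.2 ⟨ha, hg.le⟩))
      · obtain ⟨b, hb, hbt⟩ := Finset.mem_image.1 hm
        have hb' := (Finset.mem_filter.1 hb).2
        have := h _ (Finset.mem_union_right _
          (Finset.mem_image₂_of_mem (Finset.mem_filter.2 ⟨ha, hg⟩) hb))
        rw [sub_dotProduct, smul_dotProduct, smul_dotProduct, smul_eq_mul, smul_eq_mul] at this
        rw [← hbt, div_mul_eq_mul_div, div_le_iff_of_neg hb']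
        linarith
  · rintro ⟨t, ht, h⟩ a ha
    simp only [dotProduct_sub, dotProduct_smul, smul_eq_mul] at h
    rcases Finset.mem_union.1 ha with ha | ha
    · obtain ⟨ha, hg⟩ := Finset.mem_filter.1 ha
      have := h a ha
      have := mul_nonneg ht hg
      linarith
    · obtain ⟨b, hb, c, hc, rfl⟩ := Finset.mem_image₂.1 ha
      obtain ⟨hb, hbg⟩ := Finset.mem_filter.1 hb
      obtain ⟨hc, hcg⟩ := Finset.mem_filter.1 hc
      rw [sub_dotProduct, smul_dotProduct, smul_dotProduct, smul_eq_mul, smul_eq_mul]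
      have h1 := mul_nonneg hbg.le (h c hc)
      have h2 := mul_nonneg (neg_nonneg.2 hcg.le) (h b hb)
      linarith

theorem exists_isHCone_hull {n : ℕ} (s : Finset (Fin n → ℝ)) :
    ∃ t, IsHCone t (PointedCone.hull ℝ (s : Set (Fin n → ℝ))) := by
  classical
  induction s using Finset.induction_on with
  | empty =>
    refine ⟨Finset.univ.image (fun i => Pi.single i (1 : ℝ)) ∪
      Finset.univ.image (fun i => Pi.single i (-1 : ℝ)), fun v => ?_⟩
    rw [Finset.coe_empty, PointedCone.hull, Submodule.span_empty, Submodule.mem_bot]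
    constructor
    · rintro rfl
      simp
    · intro h
      ext i
      have h1 := h (Pi.single i 1) (by simp)
      have h2 := h (Pi.single i (-1)) (by simp)
      simp only [single_dotProduct] at h1 h2
      simp only [Pi.zero_apply]
      linarith
  | insert g s _ ih =>
    obtain ⟨t, ht⟩ := ih
    obtain ⟨t', ht'⟩ := exists_halfspaces_add_ray t g
    refine ⟨t', fun v => ?_⟩
    rw [ht', Finset.coe_insert, PointedCone.hull, Submodule.mem_span_insert]
    constructor
    · rintro ⟨c, z, hz, rfl⟩
      refine ⟨c, c.2, (ht _).1 ?_⟩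
      have : (c • g + z - (c : ℝ) • g) = z := by
        rw [← Nonneg.coe_smul]; abel
      rwa [this]
    · rintro ⟨c, hc, h⟩
      refine ⟨⟨c, hc⟩, v - c • g, (ht _).2 h, ?_⟩
      rw [Nonneg.mk_smul]; abel

theorem exists_isHCone_of_fg {n : ℕ} {C : PointedCone ℝ (Fin n → ℝ)} (h : Submodule.FG C) :
    ∃ t, IsHCone t C := by
  obtain ⟨s, rfl⟩ := h
  exact exists_isHCone_hull s

theorem IsHCone.dotProduct_nonneg_of_mem_hull {n : ℕ} {s : Finset (Fin n → ℝ)}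
    {C : PointedCone ℝ (Fin n → ℝ)} (h : IsHCone s C) {a v : Fin n → ℝ}
    (ha : a ∈ PointedCone.hull ℝ (s : Set (Fin n → ℝ))) (hv : v ∈ C) : 0 ≤ a ⬝ᵥ v := by
  induction ha using Submodule.span_induction with
  | mem a ha => exact (h v).1 hv a ha
  | zero => simp
  | add a b _ _ ha hb => rw [add_dotProduct]; exact add_nonneg ha hb
  | smul c a _ ha =>
    rw [← Nonneg.coe_smul, smul_dotProduct]
    exact mul_nonneg c.2 ha

/-- An intersection of finitely many half-spaces is finitely generated. -/
theorem IsHCone.fg {n : ℕ} {s : Finset (Fin n → ℝ)} {C : PointedCone ℝ (Fin n → ℝ)}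
    (h : IsHCone s C) : Submodule.FG C := by
  -- Biduality: `t` describes the cone over `s` by half-spaces, and then `t` itself generates `C`,
  -- because every normal in `r` of the cone over `t` lies in the cone over `s`.
  obtain ⟨t, ht⟩ := exists_isHCone_hull s
  obtain ⟨r, hr⟩ := exists_isHCone_hull t
  refine ⟨t, le_antisymm (Submodule.span_le.2 fun g hg => ?_) fun v hv => ?_⟩
  · refine (h g).2 fun a ha => ?_
    rw [dotProduct_comm]
    exact (ht a).1 (Submodule.subset_span ha) g hg
  · refine (hr v).2 fun a ha => ?_
    refine h.dotProduct_nonneg_of_mem_hull ((ht a).2 fun b hb => ?_) hv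
    rw [dotProduct_comm]
    exact (hr b).1 (Submodule.subset_span hb) a ha

/-- A finitely generated cone contains the end point of a half-open segment that it contains. -/
theorem mem_of_forall_add_smul_mem {n : ℕ} {C : PointedCone ℝ (Fin n → ℝ)} (hC : Submodule.FG C)
    {u v : Fin n → ℝ} (h : ∀ ε : ℝ, 0 < ε → u + ε • v ∈ C) : u ∈ C := by
  obtain ⟨s, hs⟩ := exists_isHCone_of_fg hC
  refine (hs u).2 fun a ha => ?_
  by_contra! hneg
  have key : ∀ ε : ℝ, 0 < ε → 0 ≤ a ⬝ᵥ u + ε * (a ⬝ᵥ v) := fun ε hε => by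
    simpa [dotProduct_add, dotProduct_smul] using (hs _).1 (h ε hε) a ha
  have hpos : 0 < |a ⬝ᵥ v| + 1 := by positivity
  -- With this `ε` the perturbation makes up for at most half of the negative value `a ⬝ᵥ u`.
  have := key (-(a ⬝ᵥ u) / 2 / (|a ⬝ᵥ v| + 1)) (by have := neg_pos.2 hneg; positivity)
  rw [div_mul_eq_mul_div, ← mul_div_assoc'] at this
  have h1 : a ⬝ᵥ v / (|a ⬝ᵥ v| + 1) ≤ 1 := by
    rw [div_le_one hpos]
    linarith [le_abs_self (a ⬝ᵥ v)]
  nlinarith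

/-! ### Small perturbations -/

theorem exists_pos_forall_mul_lt {ι : Type*} [Finite ι] (a b : ι → ℝ) :
    ∃ ε : ℝ, 0 < ε ∧ ∀ i, 0 < a i → ε * b i < a i := by
  have h : ∀ᶠ ε : ℝ in nhdsWithin 0 (Set.Ioi 0), ∀ i, 0 < a i → ε * b i < a i := by
    refine Filter.eventually_all.2 fun i => ?_
    by_cases hi : 0 < a i
    · have : Filter.Tendsto (fun ε : ℝ => ε * b i) (nhdsWithin 0 (Set.Ioi 0)) (nhds 0) := by
        have h0 : Filter.Tendsto (fun ε : ℝ => ε * b i) (nhds 0) (nhds (0 * b i)) :=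
          (continuous_id.mul continuous_const).tendsto 0
        rw [zero_mul] at h0
        exact h0.mono_left nhdsWithin_le_nhds
      filter_upwards [this.eventually (gt_mem_nhds hi)] with ε h _ using h
    · exact Filter.Eventually.of_forall fun _ h => absurd h hi
  obtain ⟨ε, h1, h2⟩ := (h.and self_mem_nhdsWithin).exists
  exact ⟨ε, h2, h1⟩

/-- Small perturbations of a vector refine the order of its coordinates. -/
theorem exists_pos_forall_add_smul_lt {n : ℕ} (u v : Fin n → ℝ) :
    ∃ ε : ℝ, 0 < ε ∧ ∀ i j, u i < u j → (u + ε • v) i < (u + ε • v) j := by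
  obtain ⟨ε, hε, h⟩ := exists_pos_forall_mul_lt
    (fun p : Fin n × Fin n => u p.2 - u p.1) (fun p => v p.1 - v p.2)
  refine ⟨ε, hε, fun i j hij => ?_⟩
  have := h (i, j) (sub_pos.2 hij)
  simp only [Pi.add_apply, Pi.smul_apply, smul_eq_mul]
  linarith

theorem permEquivalent_of_lt_of_eq {n : ℕ} {u v : Fin n → ℝ}
    (hlt : ∀ i j, u i < u j → v i < v j) (heq : ∀ i j, u i = u j → v i = v j) :
    PermEquivalent u v := by
  refine fun i j => ⟨⟨hlt i j, fun h => ?_⟩, ⟨heq i j, fun h => ?_⟩⟩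
  · rcases lt_trichotomy (u i) (u j) with h' | h' | h'
    · exact h'
    · exact absurd (heq i j h') h.ne
    · exact absurd (hlt j i h') h.not_gt
  · rcases lt_trichotomy (u i) (u j) with h' | h' | h'
    · exact absurd h (hlt i j h').ne
    · exact h'
    · exact absurd h (hlt j i h').ne'

theorem PermEquivalent.symm {n : ℕ} {u v : Fin n → ℝ} (h : PermEquivalent u v) :
    PermEquivalent v u :=
  fun i j => ⟨(h i j).1.symm, (h i j).2.symm⟩

/-- Used with the face axiom: in `u = ε • v + (u - ε • v)` both summands lie in a cone, so a face
containing `u` also contains `v`. -/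
theorem PermEquivalent.exists_sub_smul {n : ℕ} {u v : Fin n → ℝ}
    (h : ∀ i j, u i = u j → v i = v j) :
    ∃ ε : ℝ, 0 < ε ∧ PermEquivalent u (u - ε • v) := by
  obtain ⟨ε, hε, hlt⟩ := exists_pos_forall_add_smul_lt u (-v)
  rw [smul_neg, ← sub_eq_add_neg] at hlt
  refine ⟨ε, hε, permEquivalent_of_lt_of_eq hlt fun i j hij => ?_⟩
  simp [hij, h i j hij]

/-! ### Rank vectors -/

/-- The rank vector of a permutation, as a data vector. -/
def rankVec {n : ℕ} (ρ : Equiv.Perm (Fin n)) : Fin n → ℝ := fun i => (ρ i : ℕ)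

@[simp] theorem rankVec_lt {n : ℕ} {ρ : Equiv.Perm (Fin n)} {i j : Fin n} :
    rankVec ρ i < rankVec ρ j ↔ ρ i < ρ j := by
  simp [rankVec]

@[simp] theorem rankVec_le {n : ℕ} {ρ : Equiv.Perm (Fin n)} {i j : Fin n} :
    rankVec ρ i ≤ rankVec ρ j ↔ ρ i ≤ ρ j := by
  simp [rankVec]

@[simp] theorem rankVec_inj {n : ℕ} {ρ : Equiv.Perm (Fin n)} {i j : Fin n} :
    rankVec ρ i = rankVec ρ j ↔ i = j := by
  simp [rankVec, Fin.val_inj]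

theorem rankVec_mem_chamber {n : ℕ} (ρ : Equiv.Perm (Fin n)) : rankVec ρ ∈ chamber ρ :=
  fun _ _ h => (rankVec_lt.2 h).le

theorem exists_permEquivalent_rankVec {n : ℕ} {w : Fin n → ℝ} (hw : Function.Injective w) :
    ∃ σ : Equiv.Perm (Fin n), PermEquivalent w (rankVec σ) := by
  refine ⟨(Tuple.sort w).symm, (permEquivalent_of_lt_of_eq (fun i j h => ?_) fun i j h => ?_).symm⟩
  · rw [rankVec_lt] at h
    have hmono := (Tuple.monotone_sort w).strictMono_of_injective
      (hw.comp (Tuple.sort w).injective)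
    simpa using hmono h
  · rw [rankVec_inj] at h
    rw [h]

/-- Every vector `u` lies in a chamber whose interior contains a small perturbation of `u` in a
given generic direction. -/
theorem exists_mem_chamber {n : ℕ} (u : Fin n → ℝ) (ρ : Equiv.Perm (Fin n)) :
    ∃ σ : Equiv.Perm (Fin n), u ∈ chamber σ ∧
      ∃ ε : ℝ, 0 < ε ∧ PermEquivalent (u + ε • rankVec ρ) (rankVec σ) := by
  obtain ⟨ε, hε, hlt⟩ := exists_pos_forall_add_smul_lt u (rankVec ρ)
  have hinj : Function.Injective (u + ε • rankVec ρ) := by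
    intro i j hij
    have huij : u i = u j := by
      rcases lt_trichotomy (u i) (u j) with h | h | h
      · exact absurd hij (hlt i j h).ne
      · exact h
      · exact absurd hij (hlt j i h).ne'
    simpa [huij, hε.ne'] using hij
  obtain ⟨σ, hσ⟩ := exists_permEquivalent_rankVec hinj
  refine ⟨σ, fun i j hij => ?_, ε, hε, hσ⟩
  by_contra! h
  exact ((hσ i j).1.2 (rankVec_lt.2 hij)).not_gt (hlt j i h)

/-! ### A fan is determined by its rank test -/

theorem IsCoarsening.mem_of_permEquivalent {n : ℕ} {F : Set (PointedCone ℝ (Fin n → ℝ))}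
    (hF : IsCoarsening F) {C : PointedCone ℝ (Fin n → ℝ)} (hC : C ∈ F) {u v : Fin n → ℝ}
    (hu : u ∈ C) (huv : PermEquivalent u v) : v ∈ C := by
  obtain ⟨D, hD, hDu⟩ := hF.2 u
  have hface := hF.1.inter_face D hD C hC
  obtain ⟨ε, hε, hsub⟩ := PermEquivalent.exists_sub_smul fun i j => (huv i j).2.1
  refine (hface.mem_of_smul_add_mem (hDu v huv) (hDu _ hsub) hε ?_).2
  rw [add_sub_cancel]
  exact ⟨hDu u fun i j => ⟨.rfl, .rfl⟩, hu⟩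

/-- The chamber is the closure of the equivalence class of its rank vector: adding a small multiple
of `rankVec σ` moves any of its points into that class. -/
theorem IsCoarsening.chamber_subset {n : ℕ} {F : Set (PointedCone ℝ (Fin n → ℝ))}
    (hF : IsCoarsening F) {C : PointedCone ℝ (Fin n → ℝ)} (hC : C ∈ F)
    {σ : Equiv.Perm (Fin n)} (hσ : rankVec σ ∈ C) :
    chamber σ ⊆ (C : Set (Fin n → ℝ)) := by
  intro u hu
  refine mem_of_forall_add_smul_mem (hF.1.polyhedral C hC) (v := rankVec σ) fun ε hε => ?_
  refine hF.mem_of_permEquivalent hC hσ (permEquivalent_of_lt_of_eq (fun i j h => ?_) ?_)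
  · have h1 := hu i j (rankVec_lt.1 h)
    have h2 := mul_lt_mul_of_pos_left h hε
    simp only [Pi.add_apply, Pi.smul_apply, smul_eq_mul]
    linarith
  · intro i j h
    rw [rankVec_inj.1 h]

/-- The coordinates of `rankVec σ` are distinct, so a small step in any direction stays in its class
and hence in `C`. Thus `rankVec σ` is interior to `C`, and a face of `C` containing it is all of
`C`. -/
theorem IsCoarsening.le_of_rankVec_mem {n : ℕ} {F : Set (PointedCone ℝ (Fin n → ℝ))}
    (hF : IsCoarsening F) {C D : PointedCone ℝ (Fin n → ℝ)} (hC : C ∈ F) (hD : D ∈ F)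
    {σ : Equiv.Perm (Fin n)} (hσC : rankVec σ ∈ C) (hσD : rankVec σ ∈ D) : C ≤ D := by
  intro v hv
  obtain ⟨ε, hε, hsub⟩ := PermEquivalent.exists_sub_smul (u := rankVec σ) (v := v)
    fun i j h => by rw [rankVec_inj.1 h]
  refine ((hF.1.inter_face C hC D hD).mem_of_smul_add_mem hv
    (hF.mem_of_permEquivalent hC hσC hsub) hε ?_).2
  rw [add_sub_cancel]
  exact ⟨hσC, hσD⟩

/-- The full-dimensional cones of a coarsening are the unions of chambers of a class. -/
theorem IsFanOf.mem_iff {n : ℕ} {F : Set (PointedCone ℝ (Fin n → ℝ))}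
    {τ : Setoid (Equiv.Perm (Fin n))} (hF : IsFanOf F τ) {C : PointedCone ℝ (Fin n → ℝ)}
    (hC : C ∈ F) {ρ : Equiv.Perm (Fin n)} (hρ : rankVec ρ ∈ C) (u : Fin n → ℝ) :
    u ∈ C ↔ ∃ σ, τ ρ σ ∧ u ∈ chamber σ := by
  constructor
  · intro hu
    obtain ⟨σ, huσ, ε, hε, hσ⟩ := exists_mem_chamber u ρ
    have hmem : rankVec σ ∈ C :=
      hF.1.mem_of_permEquivalent hC (C.add_mem hu (C.smul_mem hε.le hρ)) hσ
    exact ⟨σ, (hF.2 ρ σ).2 ⟨C, hC, hF.1.chamber_subset hC hρ, hF.1.chamber_subset hC hmem⟩, huσ⟩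
  · rintro ⟨σ, hσ, hu⟩
    obtain ⟨D, hD, hρD, hσD⟩ := (hF.2 ρ σ).1 hσ
    exact hF.1.le_of_rankVec_mem hD hC (hρD (rankVec_mem_chamber ρ)) hρ (hσD hu)

/-- Every cone of a coarsening is a face of a full-dimensional one. -/
theorem IsCoarsening.exists_isFaceOf {n : ℕ} {F : Set (PointedCone ℝ (Fin n → ℝ))}
    (hF : IsCoarsening F) {D : PointedCone ℝ (Fin n → ℝ)} (hD : D ∈ F) :
    ∃ C ∈ F, ∃ ρ : Equiv.Perm (Fin n), rankVec ρ ∈ C ∧ D.IsFaceOf C := by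
  obtain ⟨s, hs⟩ := hF.1.polyhedral D hD
  have hsD : ∀ g : s, (g : Fin n → ℝ) ∈ D := fun g => hs ▸ Submodule.subset_span g.2
  -- The sum of the generators is relatively interior to `D`: a face of `D` containing it contains
  -- every generator. The direction `1` is arbitrary.
  obtain ⟨σ, hu, -⟩ := exists_mem_chamber (∑ g : s, (g : Fin n → ℝ)) 1
  obtain ⟨C, hC, hσ⟩ := hF.2 (rankVec σ)
  have hσC : rankVec σ ∈ C := hσ _ fun i j => ⟨.rfl, .rfl⟩
  have hDC : D ≤ C := by
    have := (hF.1.inter_face D hD C hC).mem_of_sum_mem hsD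
      ⟨sum_mem fun g _ => hsD g, hF.chamber_subset hC hσC hu⟩
    refine hs.symm.le.trans (Submodule.span_le.2 fun g hg => (this ⟨g, hg⟩).2)
  refine ⟨C, hC, σ, hσC, ?_⟩
  have := hF.1.inter_face C hC D hD
  rwa [inf_eq_right.2 hDC] at this

theorem IsFanOf.subset {n : ℕ} {F F' : Set (PointedCone ℝ (Fin n → ℝ))}
    {τ : Setoid (Equiv.Perm (Fin n))} (hF : IsFanOf F τ) (hF' : IsFanOf F' τ) : F ⊆ F' := by
  intro D hD
  obtain ⟨C, hC, ρ, hρ, hface⟩ := hF.1.exists_isFaceOf hD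
  obtain ⟨C', hC', hρ'⟩ := hF'.1.2 (rankVec ρ)
  have hmem : rankVec ρ ∈ C' := hρ' _ fun i j => ⟨.rfl, .rfl⟩
  have : C = C' := by
    ext u
    rw [hF.mem_iff hC hρ, hF'.mem_iff hC' hmem]
  exact hF'.1.1.face_mem C' hC' D (this ▸ hface)

theorem IsFanOf.unique {n : ℕ} {F F' : Set (PointedCone ℝ (Fin n → ℝ))}
    {τ : Setoid (Equiv.Perm (Fin n))} (hF : IsFanOf F τ) (hF' : IsFanOf F' τ) : F = F' :=
  (hF.subset hF').antisymm (hF'.subset hF)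

/-! ### The opposite fan -/

theorem mem_map_neg {n : ℕ} {C : PointedCone ℝ (Fin n → ℝ)} {u : Fin n → ℝ} :
    u ∈ PointedCone.map (-LinearMap.id : (Fin n → ℝ) →ₗ[ℝ] (Fin n → ℝ)) C ↔ -u ∈ C := by
  rw [PointedCone.mem_map]
  constructor
  · rintro ⟨x, hx, rfl⟩
    simpa using hx
  · exact fun h => ⟨-u, h, by simp⟩

theorem map_neg_map_neg {n : ℕ} (C : PointedCone ℝ (Fin n → ℝ)) :
    PointedCone.map (-LinearMap.id : (Fin n → ℝ) →ₗ[ℝ] (Fin n → ℝ))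
      (PointedCone.map (-LinearMap.id) C) = C := by
  ext u
  rw [mem_map_neg, mem_map_neg, neg_neg]

theorem neg_injective_linearMap {n : ℕ} :
    Function.Injective (-LinearMap.id : (Fin n → ℝ) →ₗ[ℝ] (Fin n → ℝ)) :=
  neg_injective

theorem IsFan.oppositeFan {n : ℕ} {F : Set (PointedCone ℝ (Fin n → ℝ))} (hF : IsFan F) :
    IsFan (oppositeFan F) where
  finite := hF.finite.image _
  polyhedral := by
    rintro _ ⟨C, hC, rfl⟩
    exact (hF.polyhedral C hC).map _
  face_mem := by
    rintro _ ⟨C, hC, rfl⟩ D hD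
    refine ⟨PointedCone.map (-LinearMap.id) D, hF.face_mem C hC _ ?_, map_neg_map_neg D⟩
    have := hD.map _ neg_injective_linearMap
    rwa [map_neg_map_neg] at this
  inter_face := by
    rintro _ ⟨C, hC, rfl⟩ _ ⟨D, hD, rfl⟩
    have := (hF.inter_face C hC D hD).map _ neg_injective_linearMap
    convert this using 1
    ext u
    simp only [Submodule.mem_inf, mem_map_neg]

theorem mem_chamber_reverse {n : ℕ} {ρ : Equiv.Perm (Fin n)} {u : Fin n → ℝ} :
    u ∈ chamber (reverse ρ) ↔ -u ∈ chamber ρ := by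
  simp only [chamber, reverse, Set.mem_ofPred_eq, Equiv.trans_apply, Fin.revPerm_apply,
    Fin.rev_lt_rev, Pi.neg_apply, neg_le_neg_iff]
  exact forall_comm

theorem chamber_reverse_subset {n : ℕ} {ρ : Equiv.Perm (Fin n)}
    {C : PointedCone ℝ (Fin n → ℝ)} :
    chamber (reverse ρ) ⊆ (C : Set (Fin n → ℝ)) ↔
      chamber ρ ⊆ (PointedCone.map (-LinearMap.id : (Fin n → ℝ) →ₗ[ℝ] (Fin n → ℝ)) C :
        Set (Fin n → ℝ)) := by
  constructor
  · intro h u hu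
    exact mem_map_neg.2 (h (mem_chamber_reverse.2 (by rwa [neg_neg])))
  · intro h u hu
    have := mem_map_neg.1 (h (mem_chamber_reverse.1 hu))
    rwa [neg_neg] at this

theorem IsFanOf.oppositeFan {n : ℕ} {F : Set (PointedCone ℝ (Fin n → ℝ))}
    {τ : Setoid (Equiv.Perm (Fin n))} (hF : IsFanOf F τ) :
    IsFanOf (oppositeFan F) (τ.comap reverse) := by
  refine ⟨⟨hF.1.1.oppositeFan, fun u => ?_⟩, fun ρ ρ' => ?_⟩
  · obtain ⟨C, hC, h⟩ := hF.1.2 (-u)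
    refine ⟨_, ⟨C, hC, rfl⟩, fun v hv => mem_map_neg.2 (h _ fun i j => ?_)⟩
    simpa [eq_comm] using hv j i
  · rw [Setoid.comap_rel, hF.2]
    simp only [chamber_reverse_subset]
    constructor
    · rintro ⟨C, hC, h⟩
      exact ⟨_, ⟨C, hC, rfl⟩, h⟩
    · rintro ⟨_, ⟨C, hC, rfl⟩, h⟩
      exact ⟨C, hC, h⟩

/-! ### Normal fans of Minkowski sums of simplices -/

/-- On every member of `𝒦`, the coordinates of `v` are maximal wherever those of `u` are. -/
def ArgmaxLE {n : ℕ} (𝒦 : Finset (Finset (Fin n))) (u v : Fin n → ℝ) : Prop :=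
  ∀ K ∈ 𝒦, ∀ k ∈ K, (∀ j ∈ K, u j ≤ u k) → ∀ j ∈ K, v j ≤ v k

theorem ArgmaxLE.refl {n : ℕ} {𝒦 : Finset (Finset (Fin n))} (u : Fin n → ℝ) : ArgmaxLE 𝒦 u u :=
  fun _ _ _ _ h => h

theorem ArgmaxLE.trans {n : ℕ} {𝒦 : Finset (Finset (Fin n))} {u v w : Fin n → ℝ}
    (h : ArgmaxLE 𝒦 u v) (h' : ArgmaxLE 𝒦 v w) : ArgmaxLE 𝒦 u w :=
  fun K hK k hk hu => h' K hK k hk (h K hK k hk hu)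

theorem single_mem_simplex {n : ℕ} {K : Finset (Fin n)} {k : Fin n} (hk : k ∈ K) :
    Pi.single k (1 : ℝ) ∈ simplex K :=
  subset_convexHull ℝ _ ⟨k, hk, rfl⟩

theorem simplex_subset {n : ℕ} (K : Finset (Fin n)) :
    simplex K ⊆ {x | (∀ k, 0 ≤ x k) ∧ (∀ k ∉ K, x k = 0) ∧ ∑ k ∈ K, x k = 1} := by
  refine convexHull_min ?_ ?_
  · rintro _ ⟨k, hk, rfl⟩
    refine ⟨fun j => ?_, fun j hj => ?_, ?_⟩
    · by_cases h : j = k <;> simp [h]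
    · exact Pi.single_eq_of_ne (ne_of_mem_of_not_mem hk hj).symm _
    · simpa [Pi.single_apply] using hk
  · rintro x ⟨hx0, hx1, hx2⟩ y ⟨hy0, hy1, hy2⟩ a b ha hb hab
    refine ⟨fun k => ?_, fun k hk => ?_, ?_⟩
    · exact add_nonneg (mul_nonneg ha (hx0 k)) (mul_nonneg hb (hy0 k))
    · simp [hx1 k hk, hy1 k hk]
    · simp [Finset.sum_add_distrib, ← Finset.mul_sum, hx2, hy2, hab]

theorem dotProduct_eq_sum_of_mem_simplex {n : ℕ} {K : Finset (Fin n)} {x : Fin n → ℝ}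
    (hx : x ∈ simplex K) (u : Fin n → ℝ) : u ⬝ᵥ x = ∑ k ∈ K, u k * x k :=
  (Finset.sum_subset (Finset.subset_univ K) fun k _ hk => by
    rw [(simplex_subset K hx).2.1 k hk, mul_zero]).symm

theorem sub_dotProduct_of_mem_simplex {n : ℕ} {K : Finset (Fin n)} {x : Fin n → ℝ}
    (hx : x ∈ simplex K) (u : Fin n → ℝ) (m : ℝ) :
    m - u ⬝ᵥ x = ∑ k ∈ K, (m - u k) * x k := by
  rw [dotProduct_eq_sum_of_mem_simplex hx]
  simp only [sub_mul, Finset.sum_sub_distrib, ← Finset.mul_sum, (simplex_subset K hx).2.2, mul_one]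

theorem dotProduct_le_of_mem_simplex {n : ℕ} {K : Finset (Fin n)} {x : Fin n → ℝ}
    (hx : x ∈ simplex K) {u : Fin n → ℝ} {m : ℝ} (h : ∀ k ∈ K, u k ≤ m) : u ⬝ᵥ x ≤ m := by
  rw [← sub_nonneg, sub_dotProduct_of_mem_simplex hx]
  exact Finset.sum_nonneg fun k hk =>
    mul_nonneg (sub_nonneg.2 (h k hk)) ((simplex_subset K hx).1 k)

/-- A point of a simplex that maximizes `u` also maximizes `v` if all vertices that maximize `u`
maximize `v`. -/
theorem le_dotProduct_of_mem_simplex {n : ℕ} {K : Finset (Fin n)} {x : Fin n → ℝ}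
    (hx : x ∈ simplex K) {u v : Fin n → ℝ} {m m' : ℝ} (hm : ∀ k ∈ K, u k ≤ m) (hxm : m ≤ u ⬝ᵥ x)
    (h : ∀ k ∈ K, u k = m → v k = m') : m' ≤ v ⬝ᵥ x := by
  have h0 : ∑ k ∈ K, (m - u k) * x k = 0 := by
    rw [← sub_dotProduct_of_mem_simplex hx]
    linarith [dotProduct_le_of_mem_simplex hx hm]
  have h1 := (Finset.sum_eq_zero_iff_of_nonneg fun k hk =>
    mul_nonneg (sub_nonneg.2 (hm k hk)) ((simplex_subset K hx).1 k)).1 h0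
  rw [← sub_nonpos, sub_dotProduct_of_mem_simplex hx]
  refine (Finset.sum_eq_zero fun k hk => ?_).le
  rcases mul_eq_zero.1 (h1 k hk) with h2 | h2
  · rw [h k hk (by linarith), sub_self, zero_mul]
  · rw [h2, mul_zero]

open scoped Pointwise in
theorem mem_mssPolytope {n : ℕ} {𝒦 : Finset (Finset (Fin n))} {x : Fin n → ℝ} :
    x ∈ mssPolytope 𝒦 ↔ ∃ g : Finset (Fin n) → Fin n → ℝ, (∀ K ∈ 𝒦, g K ∈ simplex K) ∧
      ∑ K ∈ 𝒦, g K = x := by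
  rw [mssPolytope, Set.mem_finsetSum]
  exact ⟨fun ⟨g, hg, h⟩ => ⟨g, fun K hK => hg hK, h⟩, fun ⟨g, hg, h⟩ => ⟨g, fun hK => hg _ hK, h⟩⟩

/-- A choice, for every member of `𝒦`, of a vertex of its simplex that maximizes `u`. -/
def IsVertexChoice {n : ℕ} (𝒦 : Finset (Finset (Fin n))) (u : Fin n → ℝ)
    (g : Finset (Fin n) → Fin n → ℝ) : Prop :=
  ∀ K ∈ 𝒦, ∃ k ∈ K, (∀ j ∈ K, u j ≤ u k) ∧ g K = Pi.single k 1

theorem exists_isVertexChoice {n : ℕ} {𝒦 : Finset (Finset (Fin n))} (h𝒦 : ∀ K ∈ 𝒦, K.Nonempty)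
    (u : Fin n → ℝ) : ∃ g, IsVertexChoice 𝒦 u g := by
  have : ∀ K : Finset (Fin n), ∃ x : Fin n → ℝ, K ∈ 𝒦 →
      ∃ k ∈ K, (∀ j ∈ K, u j ≤ u k) ∧ x = Pi.single k 1 := by
    intro K
    by_cases hK : K ∈ 𝒦
    · obtain ⟨k, hk, h⟩ := Finset.exists_max_image K u (h𝒦 K hK)
      exact ⟨_, fun _ => ⟨k, hk, h, rfl⟩⟩
    · exact ⟨0, fun h => absurd h hK⟩
  choose g hg using this
  exact ⟨g, hg⟩

theorem IsVertexChoice.update {n : ℕ} {𝒦 : Finset (Finset (Fin n))} {u : Fin n → ℝ}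
    {g : Finset (Fin n) → Fin n → ℝ} (hg : IsVertexChoice 𝒦 u g) {K : Finset (Fin n)} {k : Fin n}
    (hk : k ∈ K) (h : ∀ j ∈ K, u j ≤ u k) :
    IsVertexChoice 𝒦 u (Function.update g K (Pi.single k 1)) := by
  intro L hL
  rcases eq_or_ne L K with rfl | hne
  · exact ⟨k, hk, h, Function.update_self ..⟩
  · rw [Function.update_of_ne hne]
    exact hg L hL

theorem IsVertexChoice.mem_simplex {n : ℕ} {𝒦 : Finset (Finset (Fin n))} {u : Fin n → ℝ}
    {g : Finset (Fin n) → Fin n → ℝ} (hg : IsVertexChoice 𝒦 u g) {K : Finset (Fin n)}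
    (hK : K ∈ 𝒦) : g K ∈ simplex K := by
  obtain ⟨k, hk, -, h⟩ := hg K hK
  exact h ▸ single_mem_simplex hk

theorem IsVertexChoice.dotProduct_le {n : ℕ} {𝒦 : Finset (Finset (Fin n))} {u : Fin n → ℝ}
    {g : Finset (Fin n) → Fin n → ℝ} (hg : IsVertexChoice 𝒦 u g) {K : Finset (Fin n)}
    (hK : K ∈ 𝒦) {x : Fin n → ℝ} (hx : x ∈ simplex K) : u ⬝ᵥ x ≤ u ⬝ᵥ g K := by
  obtain ⟨k, -, h, hgk⟩ := hg K hK
  rw [hgk, dotProduct_single_one]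
  exact dotProduct_le_of_mem_simplex hx h

theorem IsVertexChoice.mem_maxFace {n : ℕ} {𝒦 : Finset (Finset (Fin n))} {u : Fin n → ℝ}
    {g : Finset (Fin n) → Fin n → ℝ} (hg : IsVertexChoice 𝒦 u g) :
    ∑ K ∈ 𝒦, g K ∈ maxFace (mssPolytope 𝒦) u := by
  refine ⟨mem_mssPolytope.2 ⟨g, fun K hK => hg.mem_simplex hK, rfl⟩, fun y hy => ?_⟩
  obtain ⟨y', hy', rfl⟩ := mem_mssPolytope.1 hy
  rw [dotProduct_sum, dotProduct_sum]
  exact Finset.sum_le_sum fun K hK => hg.dotProduct_le hK (hy' K hK)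

/-- The normal cone of a Minkowski sum of simplices at the face that maximizes `u`. -/
theorem mem_normalCone_maxFace {n : ℕ} {𝒦 : Finset (Finset (Fin n))} (h𝒦 : ∀ K ∈ 𝒦, K.Nonempty)
    {u v : Fin n → ℝ} :
    v ∈ normalCone (mssPolytope 𝒦) (maxFace (mssPolytope 𝒦) u) ↔ ArgmaxLE 𝒦 u v := by
  obtain ⟨g, hg⟩ := exists_isVertexChoice h𝒦 u
  constructor
  · intro h K hK k hk hmax j hj
    -- Two points of the polytope that differ only in the summand for `K`, with vertices `k` and
    -- `j`, isolate the inequality for that single summand.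
    have hx := (hg.update hk hmax).mem_maxFace
    have hy : ∑ L ∈ 𝒦, Function.update g K (Pi.single j 1) L ∈ mssPolytope 𝒦 := by
      refine mem_mssPolytope.2 ⟨_, fun L hL => ?_, rfl⟩
      rcases eq_or_ne L K with rfl | hne
      · rw [Function.update_self]
        exact single_mem_simplex hj
      · rw [Function.update_of_ne hne]
        exact hg.mem_simplex hL
    have := h _ hx _ hy
    simpa [Finset.sum_update_of_mem hK, dotProduct_add] using this
  · intro h x hx y hy
    obtain ⟨x', hx', rfl⟩ := mem_mssPolytope.1 hx.1
    obtain ⟨y', hy', rfl⟩ := mem_mssPolytope.1 hy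
    have heq := hx.2 _ hg.mem_maxFace.1
    rw [dotProduct_sum, dotProduct_sum] at heq ⊢
    have hle : ∀ K ∈ 𝒦, u ⬝ᵥ x' K ≤ u ⬝ᵥ g K := fun K hK => hg.dotProduct_le hK (hx' K hK)
    -- A point maximizing `u` on the sum has each of its summands maximizing `u`.
    have hterm := (Finset.sum_eq_sum_iff_of_le hle).1 (le_antisymm (Finset.sum_le_sum hle) heq)
    refine Finset.sum_le_sum fun K hK => ?_
    obtain ⟨k, hk, hmax, hgk⟩ := hg K hK
    have hxk := hterm K hK
    rw [hgk, dotProduct_single_one] at hxk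
    refine (dotProduct_le_of_mem_simplex (hy' K hK) (h K hK k hk hmax)).trans
      (le_dotProduct_of_mem_simplex (hx' K hK) hmax hxk.ge fun i hi hik => ?_)
    exact le_antisymm (h K hK k hk hmax i hi)
      (h K hK i hi (fun j hj => (hmax j hj).trans hik.ge) k hk)

theorem mem_normalFan_iff {n : ℕ} {𝒦 : Finset (Finset (Fin n))} (h𝒦 : ∀ K ∈ 𝒦, K.Nonempty)
    {C : PointedCone ℝ (Fin n → ℝ)} :
    C ∈ normalFan (mssPolytope 𝒦) ↔ ∃ u, ∀ v, v ∈ C ↔ ArgmaxLE 𝒦 u v := by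
  constructor
  · rintro ⟨u, -, rfl⟩
    exact ⟨u, fun v => mem_normalCone_maxFace h𝒦⟩
  · rintro ⟨u, hu⟩
    obtain ⟨g, hg⟩ := exists_isVertexChoice h𝒦 u
    refine ⟨u, ⟨_, hg.mem_maxFace⟩, ?_⟩
    ext v
    rw [hu, mem_normalCone_maxFace h𝒦]

theorem normalCone_maxFace_mem_normalFan {n : ℕ} {𝒦 : Finset (Finset (Fin n))}
    (h𝒦 : ∀ K ∈ 𝒦, K.Nonempty) (u : Fin n → ℝ) :
    normalCone (mssPolytope 𝒦) (maxFace (mssPolytope 𝒦) u) ∈ normalFan (mssPolytope 𝒦) :=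
  (mem_normalFan_iff h𝒦).2 ⟨u, fun _ => mem_normalCone_maxFace h𝒦⟩

/-- A submodule of `ℝⁿ` over the nonnegative reals contains a vector whose coordinates coincide
only where those of all its members coincide. -/
theorem exists_mem_forall_eq {n : ℕ} (D : PointedCone ℝ (Fin n → ℝ)) :
    ∃ w ∈ D, ∀ v ∈ D, ∀ i j, w i = w j → v i = v j := by
  classical
  -- Take `w` with a minimal set of coinciding pairs. Adding a small multiple of `v` creates no
  -- coincidence, and by minimality it destroys none.
  obtain ⟨w, hw, hmin⟩ := exists_minimalFor_of_wellFoundedLT (fun v => v ∈ D)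
    (fun v : Fin n → ℝ => Finset.univ.filter fun p : Fin n × Fin n => v p.1 = v p.2)
    ⟨0, D.zero_mem⟩
  refine ⟨w, hw, fun v hv i j hij => ?_⟩
  obtain ⟨ε, hε, hlt⟩ := exists_pos_forall_add_smul_lt w v
  have hsub := hmin (D.add_mem hw (D.smul_mem hε.le hv)) (fun p hp => by
    simp only [Finset.mem_filter_univ] at hp ⊢
    rcases lt_trichotomy (w p.1) (w p.2) with h | h | h
    · exact absurd hp (hlt _ _ h).ne
    · exact h
    · exact absurd hp (hlt _ _ h).ne')
  have : (w + ε • v) i = (w + ε • v) j := by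
    simpa using hsub (show (i, j) ∈ _ by simpa using hij)
  simpa [hij, hε.ne'] using this

/-- Each cone is cut out by inequalities between two coordinates; this gives polyhedrality, and
finiteness because a cone is determined by the set of such inequalities valid on it. -/
theorem isFan_normalFan {n : ℕ} {𝒦 : Finset (Finset (Fin n))} (h𝒦 : ∀ K ∈ 𝒦, K.Nonempty) :
    IsFan (normalFan (mssPolytope 𝒦)) where
  finite := by
    refine Set.Finite.of_finite_image (f := fun C : PointedCone ℝ (Fin n → ℝ) =>
      {p : Fin n × Fin n | ∀ v ∈ C, v p.1 ≤ v p.2}) (Set.toFinite _) ?_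
    have key : ∀ C ∈ normalFan (mssPolytope 𝒦), ∀ D ∈ normalFan (mssPolytope 𝒦),
        {p : Fin n × Fin n | ∀ v ∈ C, v p.1 ≤ v p.2} =
          {p : Fin n × Fin n | ∀ v ∈ D, v p.1 ≤ v p.2} → C ≤ D := by
      intro C _ D hD h v hv
      obtain ⟨w, hw⟩ := (mem_normalFan_iff h𝒦).1 hD
      refine (hw v).2 fun K hK k hk hmax j hj => ?_
      have : (j, k) ∈ {p : Fin n × Fin n | ∀ v ∈ D, v p.1 ≤ v p.2} :=
        fun x hx => (hw x).1 hx K hK k hk hmax j hj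
      rw [← h] at this
      exact this v hv
    exact fun C hC D hD h => le_antisymm (key C hC D hD h) (key D hD C hC h.symm)
  polyhedral := by
    classical
    intro C hC
    obtain ⟨u, hu⟩ := (mem_normalFan_iff h𝒦).1 hC
    refine IsHCone.fg (s := (Finset.univ.filter fun p : Fin n × Fin n =>
      ∃ K ∈ 𝒦, p.1 ∈ K ∧ (∀ j ∈ K, u j ≤ u p.1) ∧ p.2 ∈ K).image
        fun p => Pi.single p.1 1 - Pi.single p.2 1) fun v => ?_
    rw [hu]
    simp only [Finset.forall_mem_image, Finset.mem_filter_univ, Prod.forall, sub_dotProduct,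
      single_one_dotProduct, sub_nonneg]
    exact ⟨fun h k j ⟨K, hK, hk, hmax, hj⟩ => h K hK k hk hmax j hj,
      fun h K hK k hk hmax j hj => h k j ⟨K, hK, hk, hmax, hj⟩⟩
  face_mem := by
    intro C hC D hD
    obtain ⟨u, hu⟩ := (mem_normalFan_iff h𝒦).1 hC
    -- The face `D` turns out to be the cone of its generic vector `w`. A `u`-maximizer on `K` also
    -- maximizes `w`, so genericity makes it tie with any `w`-maximizer throughout `D`.
    obtain ⟨w, hw, hgen⟩ := exists_mem_forall_eq D
    have huw := (hu w).1 (hD.le hw)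
    refine (mem_normalFan_iff h𝒦).2 ⟨w, fun v => ⟨fun hv K hK k hk hmax j hj => ?_, fun h => ?_⟩⟩
    · obtain ⟨m, hm, hmu⟩ := Finset.exists_max_image K u (h𝒦 K hK)
      have hmk : w m = w k := le_antisymm (hmax m hm) (huw K hK m hm hmu k hk)
      rw [← hgen v hv m k hmk]
      exact (hu v).1 (hD.le hv) K hK m hm hmu j hj
    · obtain ⟨ε, hε, hlt⟩ := exists_pos_forall_add_smul_lt w (-v)
      rw [smul_neg, ← sub_eq_add_neg] at hlt
      refine hD.mem_of_smul_add_mem (y := w - ε • v) ((hu v).2 (huw.trans h)) ?_ hε ?_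
      · refine (hu _).2 fun K hK k hk hmax j hj => ?_
        have hwk := huw K hK k hk hmax
        rcases (hwk j hj).lt_or_eq with hjk | hjk
        · exact (hlt j k hjk).le
        · have h1 := h K hK k hk hwk j hj
          have h2 := h K hK j hj (fun i hi => (hwk i hi).trans hjk.ge) k hk
          simp [hjk, le_antisymm h1 h2]
      · rwa [add_sub_cancel]
  inter_face := by
    intro C hC D hD
    obtain ⟨u, hu⟩ := (mem_normalFan_iff h𝒦).1 hC
    obtain ⟨w, hw⟩ := (mem_normalFan_iff h𝒦).1 hD
    refine ⟨inf_le_left, fun {x y a} hx hy ha hxy => ⟨hx, (hw x).2 fun K hK k hk hmax j hj => ?_⟩⟩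
    -- Both `x` and `y` are maximal at `m`. As `a • x + y` is also maximal at `k`, neither summand
    -- can be smaller at `k` than at `m`.
    obtain ⟨m, hm, hmu⟩ := Finset.exists_max_image K u (h𝒦 K hK)
    have hxm := (hu x).1 hx K hK m hm hmu
    have hym := (hu y).1 hy K hK m hm hmu
    have := (hw _).1 hxy.2 K hK k hk hmax m hm
    simp only [Pi.add_apply, Pi.smul_apply, smul_eq_mul] at this
    have h1 : x m ≤ x k := by
      refine le_of_mul_le_mul_left ?_ ha
      linarith [hym k hk]
    exact (hxm j hj).trans h1

/-! ### The Minkowski sum of simplices test -/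

theorem isGreatest_image_iff {n : ℕ} {ρ : Equiv.Perm (Fin n)} {K : Finset (Fin n)} {i : Fin n} :
    IsGreatest (ρ '' (K : Set (Fin n))) (ρ i) ↔ i ∈ K ∧ ∀ j ∈ K, rankVec ρ j ≤ rankVec ρ i := by
  simp only [IsGreatest, mem_upperBounds, Set.forall_mem_image, Finset.mem_coe, rankVec_le]
  rw [ρ.injective.mem_set_image, Finset.mem_coe]

open Classical in
/-- The signature, with the members of `𝒦` as finsets: the definition coerces them to sets. -/
theorem mssSignature_eq_card {n : ℕ} (𝒦 : Finset (Finset (Fin n))) (ρ : Equiv.Perm (Fin n))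
    (i : Fin n) : mssSignature 𝒦 ρ i =
      (𝒦.filter fun K : Finset (Fin n) => IsGreatest (ρ '' (K : Set (Fin n))) (ρ i)).card := by
  rw [← Finset.card_image_of_injective _ (Finset.coe_injective (α := Fin n))]
  refine congrArg Finset.card ?_
  ext K
  simp only [Finset.mem_filter, Finset.mem_image, Finset.bind_def, Finset.pure_def]
  constructor
  · rintro ⟨h, hK⟩
    obtain ⟨L, hL, h⟩ := by simpa using h
    exact by subst h; exact ⟨L, ⟨hL, hK⟩, rfl⟩
  · rintro ⟨L, ⟨hL, hK⟩, rfl⟩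
    exact ⟨by simpa using hL, hK⟩

/-- Each member of `𝒦` is counted exactly once, at its top position. So the signature is the vertex
of the Minkowski sum that maximizes the rank vector, expressed here through its pairings with `x`.
-/
theorem sum_mssSignature_mul {n : ℕ} {𝒦 : Finset (Finset (Fin n))} (ρ : Equiv.Perm (Fin n))
    (x : Fin n → ℝ) {g : Finset (Fin n) → Fin n → ℝ} (hg : IsVertexChoice 𝒦 (rankVec ρ) g) :
    ∑ i, (mssSignature 𝒦 ρ i : ℝ) * x i = ∑ K ∈ 𝒦, x ⬝ᵥ g K := by
  classical
  simp only [mssSignature_eq_card, Finset.card_filter, Nat.cast_sum, Finset.sum_mul]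
  rw [Finset.sum_comm]
  refine Finset.sum_congr rfl fun K hK => ?_
  obtain ⟨k, hk, hmax, hgk⟩ := hg K hK
  rw [hgk, dotProduct_single_one]
  refine (Finset.sum_eq_single k ?_ ?_).trans ?_
  rotate_left 2
  · rw [if_pos (isGreatest_image_iff.2 ⟨hk, hmax⟩), Nat.cast_one, one_mul]
  · intro i _ hik
    rw [if_neg, Nat.cast_zero, zero_mul]
    intro h
    obtain ⟨hi, h⟩ := isGreatest_image_iff.1 h
    exact hik (rankVec_inj.1 (le_antisymm (hmax i hi) (h k hk)))
  · exact fun h => absurd (Finset.mem_univ k) h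

/-- Permutations with the same signature have the same maximal positions in all members of `𝒦`. -/
theorem mssTest_iff_argmaxLE {n : ℕ} {𝒦 : Finset (Finset (Fin n))} (h𝒦 : ∀ K ∈ 𝒦, K.Nonempty)
    {ρ ρ' : Equiv.Perm (Fin n)} :
    mssTest 𝒦 ρ ρ' ↔ ArgmaxLE 𝒦 (rankVec ρ) (rankVec ρ') := by
  rw [mssTest, Setoid.ker_def]
  constructor
  · intro h K hK k hk hmax
    obtain ⟨g, hg⟩ := exists_isVertexChoice h𝒦 (rankVec ρ)
    obtain ⟨g', hg'⟩ := exists_isVertexChoice h𝒦 (rankVec ρ')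
    -- Both signatures are paired with the rank vector of `ρ`. Term by term the choices of `ρ'` give
    -- at most those of `ρ`, so equal totals force equal maximizers.
    have hsum := sum_mssSignature_mul ρ (rankVec ρ) hg
    rw [h, sum_mssSignature_mul ρ' (rankVec ρ) hg'] at hsum
    have hterm := (Finset.sum_eq_sum_iff_of_le fun L hL =>
      hg.dotProduct_le hL (hg'.mem_simplex hL)).1 hsum K hK
    obtain ⟨m, hm, hmmax, hgm⟩ := hg K hK
    obtain ⟨m', hm', hmmax', hgm'⟩ := hg' K hK
    rw [hgm, hgm', dotProduct_single_one, dotProduct_single_one, rankVec_inj] at hterm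
    have hkm : k = m := rankVec_inj.1 (le_antisymm (hmmax k hk) (hmax m hm))
    rwa [hkm, ← hterm]
  · classical
    intro h
    funext i
    rw [mssSignature_eq_card, mssSignature_eq_card]
    refine congrArg Finset.card (Finset.filter_congr fun K hK => ?_)
    rw [isGreatest_image_iff, isGreatest_image_iff]
    refine ⟨fun ⟨hi, hmax⟩ => ⟨hi, h K hK i hi hmax⟩, fun ⟨hi, hmax⟩ => ?_⟩
    obtain ⟨m, hm, hmmax⟩ := Finset.exists_max_image K (rankVec ρ) (h𝒦 K hK)
    have : m = i := rankVec_inj.1 (le_antisymm (hmax m hm) (h K hK m hm hmmax i hi))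
    exact ⟨hi, this ▸ hmmax⟩

theorem argmaxLE_of_mem_chamber {n : ℕ} {𝒦 : Finset (Finset (Fin n))} {ρ : Equiv.Perm (Fin n)}
    {v : Fin n → ℝ} (hv : v ∈ chamber ρ) : ArgmaxLE 𝒦 (rankVec ρ) v := by
  intro K _ k _ hmax j hj
  rcases (rankVec_le.1 (hmax j hj)).lt_or_eq with h | h
  · exact hv j k h
  · rw [ρ.injective h]

theorem isFanOf_mssTest {n : ℕ} {𝒦 : Finset (Finset (Fin n))} (h𝒦 : ∀ K ∈ 𝒦, K.Nonempty) :
    IsFanOf (normalFan (mssPolytope 𝒦)) (mssTest 𝒦) := by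
  refine ⟨⟨isFan_normalFan h𝒦, fun u => ⟨_, normalCone_maxFace_mem_normalFan h𝒦 u,
    fun v huv => (mem_normalCone_maxFace h𝒦).2 fun K _ k _ hmax j hj => ?_⟩⟩, fun ρ ρ' => ⟨?_, ?_⟩⟩
  · by_contra! h
    exact ((huv k j).1.2 h).not_ge (hmax j hj)
  · intro h
    rw [Setoid.comm', mssTest_iff_argmaxLE h𝒦] at h
    have h' := h
    refine ⟨_, normalCone_maxFace_mem_normalFan h𝒦 (rankVec ρ'), fun v hv => ?_, fun v hv => ?_⟩
    · exact (mem_normalCone_maxFace h𝒦).2 (h.trans (argmaxLE_of_mem_chamber hv))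
    · exact (mem_normalCone_maxFace h𝒦).2 (argmaxLE_of_mem_chamber hv)
  · rintro ⟨C, hC, hρ, hρ'⟩
    obtain ⟨u, hu⟩ := (mem_normalFan_iff h𝒦).1 hC
    have h1 := (hu _).1 (hρ (rankVec_mem_chamber ρ))
    have h2 := (hu _).1 (hρ' (rankVec_mem_chamber ρ'))
    refine (mssTest_iff_argmaxLE h𝒦).2 fun K hK k hk hmax => ?_
    -- The vector `u` may have ties, but any of its maximizers on `K` is one for `ρ` and for `ρ'`,
    -- where maximizers are unique.
    obtain ⟨m, hm, hmmax⟩ := Finset.exists_max_image K u (h𝒦 K hK)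
    have : m = k := rankVec_inj.1 (le_antisymm (hmax m hm) (h1 K hK m hm hmmax k hk))
    exact h2 K hK k hk (this ▸ hmmax)

/-! ### Walls -/

theorem descentVector_injective {n : ℕ} (ρ : Equiv.Perm (Fin n)) :
    Function.Injective (descentVector ρ) :=
  ρ.symm.injective.comp Fin.rev_injective

@[simp] theorem apply_descentVector {n : ℕ} (ρ : Equiv.Perm (Fin n)) (k : Fin n) :
    ρ (descentVector ρ k) = k.rev :=
  ρ.apply_symm_apply _

@[simp] theorem descentVector_rev_apply {n : ℕ} (ρ : Equiv.Perm (Fin n)) (i : Fin n) :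
    descentVector ρ (ρ i).rev = i := by
  simp [descentVector]

/-- Walls in terms of rank vectors: the ranks of `i` and `j` are consecutive and are exchanged. -/
theorem shareWall_iff {n : ℕ} {ρ ρ' : Equiv.Perm (Fin n)} {s : CIStatement n} :
    ShareWall ρ ρ' s ↔ (ρ s.i : ℕ) = ρ s.j + 1 ∧ (∀ x, ρ' x = ρ (Equiv.swap s.i s.j x)) ∧
      ∀ x, x ∈ s.K ↔ ρ s.i < ρ x := by
  have hswap : ∀ k l : Fin n, s.i = descentVector ρ k → s.j = descentVector ρ l →
      ((∀ m, descentVector ρ' m = descentVector ρ (Equiv.swap k l m)) ↔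
        ∀ x, ρ' x = ρ (Equiv.swap s.i s.j x)) := by
    intro k l hk hl
    simp only [(descentVector_injective ρ).map_swap, ← hk, ← hl]
    constructor
    · intro h x
      have := h (ρ' x).rev
      rw [descentVector_rev_apply] at this
      rw [← Equiv.swap_apply_eq_iff] at this
      rw [this, apply_descentVector, Fin.rev_rev]
    · intro h m
      have := h (Equiv.swap s.i s.j (descentVector ρ m))
      rw [Equiv.swap_apply_self, apply_descentVector] at this
      rw [← descentVector_rev_apply ρ' (Equiv.swap s.i s.j (descentVector ρ m)), this,
        Fin.rev_rev]
  have himage : ∀ k x, x ∈ (Finset.Iio k).image (descentVector ρ) ↔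
      ρ (descentVector ρ k) < ρ x := by
    intro k x
    rw [Finset.mem_image, apply_descentVector]
    constructor
    · rintro ⟨m, hm, rfl⟩
      rw [apply_descentVector, Fin.rev_lt_rev]
      exact Finset.mem_Iio.1 hm
    · intro h
      refine ⟨(ρ x).rev, Finset.mem_Iio.2 ?_, descentVector_rev_apply ρ x⟩
      rwa [← Fin.rev_lt_rev, Fin.rev_rev]
  constructor
  · rintro ⟨k, l, hkl, h, hi, hj, hK⟩
    refine ⟨?_, (hswap k l hi hj).1 h, fun x => ?_⟩
    · rw [hi, hj, apply_descentVector, apply_descentVector, Fin.val_rev, Fin.val_rev]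
      omega
    · rw [hK, himage, hi]
  · rintro ⟨hij, h, hK⟩
    have hi : s.i = descentVector ρ (ρ s.i).rev := (descentVector_rev_apply ρ s.i).symm
    have hj : s.j = descentVector ρ (ρ s.j).rev := (descentVector_rev_apply ρ s.j).symm
    refine ⟨(ρ s.i).rev, (ρ s.j).rev, ?_, (hswap _ _ hi hj).2 h, hi, hj, ?_⟩
    · rw [Fin.val_rev, Fin.val_rev]
      omega
    · ext x
      rw [hK, himage, ← hi]

/-- The two permutations at a wall order all other pairs of positions in the same way. -/
theorem ShareWall.eq_of_lt_of_gt {n : ℕ} {ρ ρ' : Equiv.Perm (Fin n)} {s : CIStatement n}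
    (h : ShareWall ρ ρ' s) {x y : Fin n} (hxy : ρ x < ρ y) (hyx : ρ' y < ρ' x) :
    x = s.j ∧ y = s.i := by
  obtain ⟨h1, h2, -⟩ := shareWall_iff.1 h
  have hval : ∀ z, z ≠ s.i → z ≠ s.j →
      (ρ z : ℕ) ≠ ρ s.i ∧ (ρ z : ℕ) ≠ ρ s.j := fun z hi hj =>
    ⟨fun h => hi (ρ.injective (Fin.ext h)), fun h => hj (ρ.injective (Fin.ext h))⟩
  rw [h2, h2, Equiv.swap_apply_def, Equiv.swap_apply_def, Fin.lt_def] at hyx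
  rw [Fin.lt_def] at hxy
  by_cases hxi : x = s.i
  · subst hxi
    by_cases hyj : y = s.j
    · subst hyj; omega
    · by_cases hyi : y = s.i
      · subst hyi; omega
      · have := hval y hyi hyj
        simp only [hyi, hyj, if_true, if_false] at hyx
        omega
  · by_cases hxj : x = s.j
    · subst hxj
      by_cases hyi : y = s.i
      · exact ⟨rfl, hyi⟩
      · by_cases hyj : y = s.j
        · subst hyj; omega
        · have := hval y hyi hyj
          simp only [hyi, hyj, hxi, if_true, if_false] at hyx
          omega
    · have := hval x hxi hxj
      by_cases hyi : y = s.i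
      · subst hyi
        simp only [hxi, hxj, if_true, if_false] at hyx
        omega
      · by_cases hyj : y = s.j
        · subst hyj
          simp only [hyi, hxi, hxj, if_true, if_false] at hyx
          omega
        · simp only [hyi, hyj, hxi, hxj, if_false] at hyx
          omega

/-- The statement `j ⫫ i | K`. -/
def CIStatement.flip {n : ℕ} (s : CIStatement n) : CIStatement n where
  i := s.j
  j := s.i
  K := s.K
  ne := s.ne.symm
  i_notMem := s.j_notMem
  j_notMem := s.i_notMem

@[simp] theorem CIStatement.star_star {n : ℕ} (s : CIStatement n) : s.star.star = s := by
  ext x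
  · rfl
  · rfl
  · simp only [CIStatement.star, Finset.mem_compl, Finset.mem_insert]
    constructor
    · tauto
    · intro h
      have hi : x ≠ s.i := ne_of_mem_of_not_mem h s.i_notMem
      have hj : x ≠ s.j := ne_of_mem_of_not_mem h s.j_notMem
      tauto

@[simp] theorem CIStatement.flip_flip {n : ℕ} (s : CIStatement n) : s.flip.flip = s := rfl

theorem CIStatement.flip_star {n : ℕ} (s : CIStatement n) : s.flip.star = s.star.flip := by
  ext x
  · rfl
  · rfl
  · simp [CIStatement.star, CIStatement.flip]
    tauto

theorem mem_dualModel {n : ℕ} {M : Set (CIStatement n)} {s : CIStatement n} :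
    s ∈ dualModel M ↔ s.star ∈ M := by
  constructor
  · rintro ⟨t, ht, rfl⟩
    rwa [CIStatement.star_star]
  · exact fun h => ⟨_, h, CIStatement.star_star s⟩

@[simp] theorem reverse_reverse {n : ℕ} (ρ : Equiv.Perm (Fin n)) : reverse (reverse ρ) = ρ := by
  ext x
  simp [reverse]

theorem reverse_lt {n : ℕ} {ρ : Equiv.Perm (Fin n)} {x y : Fin n} :
    reverse ρ x < reverse ρ y ↔ ρ y < ρ x := by
  simp [reverse]

/-- Reversal dualizes the labels of walls. -/
theorem ShareWall.reverse {n : ℕ} {ρ ρ' : Equiv.Perm (Fin n)} {s : CIStatement n}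
    (h : ShareWall ρ ρ' s) : ShareWall (reverse ρ) (reverse ρ') s.star.flip := by
  -- The flip is needed because a label names the higher ranked position first, and reversal
  -- exchanges the two.
  obtain ⟨h1, h2, h3⟩ := shareWall_iff.1 h
  refine shareWall_iff.2 ⟨?_, fun x => ?_, fun x => ?_⟩
  · simp only [CIStatement.flip, CIStatement.star, RankTest.reverse, Equiv.trans_apply,
      Fin.revPerm_apply, Fin.val_rev]
    omega
  · simp only [CIStatement.flip, CIStatement.star, RankTest.reverse, Equiv.trans_apply, h2,
      Equiv.swap_comm s.j]
  · simp only [CIStatement.flip, CIStatement.star, reverse_lt, Finset.mem_compl,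
      Finset.mem_insert, h3, not_or, not_lt]
    constructor
    · rintro ⟨hi, hj, hle⟩
      have hi' : (ρ x : ℕ) ≠ ρ s.i := fun h => hi (ρ.injective (Fin.ext h))
      have hj' : (ρ x : ℕ) ≠ ρ s.j := fun h => hj (ρ.injective (Fin.ext h))
      rw [Fin.le_def] at hle
      rw [Fin.lt_def]
      omega
    · intro hlt
      refine ⟨?_, ?_, ?_⟩
      · rintro rfl
        rw [Fin.lt_def] at hlt
        omega
      · rintro rfl
        exact lt_irrefl _ hlt
      · rw [Fin.lt_def] at hlt
        rw [Fin.le_def]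
        omega

theorem testOfModel_of_reverse {n : ℕ} {M N : Set (CIStatement n)}
    (h : ∀ s ∈ M, s.star.flip ∈ N) {ρ ρ' : Equiv.Perm (Fin n)} (hρ : testOfModel M ρ ρ') :
    testOfModel N (reverse ρ) (reverse ρ') := by
  have : testOfModel M ≤ (testOfModel N).comap reverse :=
    Setoid.eqvGen_le fun σ σ' ⟨s, hs, hw⟩ => .rel _ _ ⟨_, h s hs, hw.reverse⟩
  exact this hρ

/-- Every statement labels a wall. -/
theorem exists_shareWall {n : ℕ} (s : CIStatement n) : ∃ ρ ρ', ShareWall ρ ρ' s := by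
  classical
  -- Levels that rank `K` highest, then `i`, then `j`, then the rest; in `w` below, ties within a
  -- level are broken by the index, which is less than `n`.
  obtain ⟨c, hc⟩ : ∃ c : Fin n → ℕ, ∀ x, c x =
      (if x ∈ s.K then 3 else if x = s.i then 2 else if x = s.j then 1 else 0) :=
    ⟨_, fun _ => rfl⟩
  have hci : c s.i = 2 := by simp [hc, s.i_notMem]
  have hcj : c s.j = 1 := by simp [hc, s.j_notMem, s.ne.symm]
  have hcK : ∀ x ∈ s.K, c x = 3 := fun x hx => by simp [hc, hx]
  have hc0 : ∀ x, x ∉ s.K → x ≠ s.i → x ≠ s.j → c x = 0 := fun x h1 h2 h3 => by simp [hc, h1, h2, h3]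
  let w : Fin n → ℝ := fun x => ((c x * n + x : ℕ) : ℝ)
  have hw : Function.Injective w := by
    intro x y h
    have h' : c x * n + x = c y * n + y := Nat.cast_injective h
    have := congrArg (· % n) h'
    simpa [Nat.mod_eq_of_lt, Fin.val_inj] using this
  obtain ⟨ρ, hρ⟩ := exists_permEquivalent_rankVec hw
  have hlt : ∀ x y, ρ x < ρ y ↔ c x * n + x < c y * n + y := fun x y => by
    rw [← rankVec_lt, ← (hρ x y).1, Nat.cast_lt]
  have hmid : ∀ x, ρ s.j < ρ x → ρ x < ρ s.i → False := by
    intro x h1 h2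
    rw [hlt] at h1 h2
    have := x.2
    by_cases hK : x ∈ s.K
    · rw [hcK x hK, hci] at h2
      have := s.i.2
      omega
    · by_cases hi : x = s.i
      · exact absurd h2 (by rw [hi]; exact lt_irrefl _)
      · by_cases hj : x = s.j
        · subst hj; exact lt_irrefl _ h1
        · rw [hc0 x hK hi hj, hcj] at h1
          omega
  refine ⟨ρ, (Equiv.swap s.i s.j).trans ρ, shareWall_iff.2 ⟨?_, fun x => rfl, fun x => ?_⟩⟩
  · have h1 : ρ s.j < ρ s.i := by
      rw [hlt, hci, hcj]
      have := s.j.2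
      omega
    rw [Fin.lt_def] at h1
    by_contra hne
    have h2 : (ρ s.j : ℕ) + 1 < ρ s.i := by omega
    refine hmid (ρ.symm ⟨ρ s.j + 1, h2.trans (ρ s.i).2⟩) ?_ ?_
    · simp [Fin.lt_def]
    · simpa [Fin.lt_def] using h2
  · rw [hlt, hci]
    have := x.2
    have := s.i.2
    constructor
    · intro hK
      rw [hcK x hK]
      omega
    · intro h
      by_contra hK
      by_cases hi : x = s.i
      · rw [hi, hci] at h
        omega
      · by_cases hj : x = s.j
        · rw [hj, hcj] at h
          have := s.j.2
          omega
        · rw [hc0 x hK hi hj] at h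
          omega

theorem removedWalls_comap_reverse {n : ℕ} (τ : Setoid (Equiv.Perm (Fin n))) :
    removedWalls (τ.comap reverse) = {s | s.star.flip ∈ removedWalls τ} := by
  ext s
  constructor
  · rintro ⟨ρ, ρ', hw, hτ⟩
    exact ⟨_, _, hw.reverse, hτ⟩
  · rintro ⟨ρ, ρ', hw, hτ⟩
    refine ⟨reverse ρ, reverse ρ', ?_, ?_⟩
    · have := hw.reverse
      rwa [← CIStatement.flip_star, CIStatement.flip_flip, CIStatement.star_star] at this
    · rw [Setoid.comap_rel, reverse_reverse, reverse_reverse]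
      exact hτ

/-! ### Graphs and their connected vertex sets -/

theorem mem_connectedSets {n : ℕ} {G : SimpleGraph (Fin n)} {K : Finset (Fin n)} :
    K ∈ connectedSets G ↔ (G.induce (K : Set (Fin n))).Connected := by
  simp [connectedSets]

theorem connectedSets_nonempty {n : ℕ} {G : SimpleGraph (Fin n)} :
    ∀ K ∈ connectedSets G, K.Nonempty := by
  intro K hK
  obtain ⟨⟨x, hx⟩⟩ := (mem_connectedSets.1 hK).nonempty
  exact ⟨x, hx⟩

theorem support_mem_connectedSets {n : ℕ} {G : SimpleGraph (Fin n)} {i j : Fin n}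
    (p : G.Walk i j) : p.support.toFinset ∈ connectedSets G := by
  rw [mem_connectedSets, List.coe_toFinset]
  exact p.connected_induce_support

theorem exists_walk_of_mem_connectedSets {n : ℕ} {G : SimpleGraph (Fin n)} {K : Finset (Fin n)}
    (hK : K ∈ connectedSets G) {i j : Fin n} (hi : i ∈ K) (hj : j ∈ K) :
    ∃ p : G.Walk i j, ∀ x ∈ p.support, x ∈ K := by
  obtain ⟨p⟩ := (mem_connectedSets.1 hK).preconnected ⟨i, hi⟩ ⟨j, hj⟩
  let q := p.map (SimpleGraph.Embedding.induce (K : Set (Fin n))).toHom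
  have hq : ∀ x ∈ q.support, x ∈ K := fun x hx => ?_
  · exact ⟨q, hq⟩
  rw [SimpleGraph.Walk.support_map, List.mem_map] at hx
  obtain ⟨y, -, rfl⟩ := hx
  exact y.2

/-- A connected set that meets a set `S` and its complement has an edge leaving `S`. -/
theorem exists_adj_of_mem_connectedSets {n : ℕ} {G : SimpleGraph (Fin n)} {K : Finset (Fin n)}
    (hK : K ∈ connectedSets G) (S : Finset (Fin n)) {i j : Fin n} (hi : i ∈ K) (hj : j ∈ K)
    (hiS : i ∈ S) (hjS : j ∉ S) :
    ∃ a ∈ K, ∃ b ∈ K, a ∈ S ∧ b ∉ S ∧ G.Adj a b := by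
  obtain ⟨p, hp⟩ := exists_walk_of_mem_connectedSets hK hi hj
  obtain ⟨d, hd, ha, hb⟩ := p.exists_boundary_dart S hiS hjS
  exact ⟨_, hp _ (p.dart_fst_mem_support_of_mem_darts hd), _,
    hp _ (p.dart_snd_mem_support_of_mem_darts hd), ha, hb, d.adj⟩

/-! ### The walls removed by the graphical model rank test -/

theorem flip_mem_graphicalModel {n : ℕ} {G : SimpleGraph (Fin n)} {s : CIStatement n} :
    s.flip ∈ graphicalModel G ↔ s ∈ graphicalModel G := by
  have key : ∀ t : CIStatement n, (∃ p : G.Walk t.i t.j, ∀ x ∈ p.support, x ∉ t.K) →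
      ∃ p : G.Walk t.j t.i, ∀ x ∈ p.support, x ∉ t.K :=
    fun t ⟨p, hp⟩ => ⟨p.reverse, fun x hx => hp x (by simpa using hx)⟩
  exact not_congr ⟨key s.flip, key s⟩

theorem graphicalModelTest_iff {n : ℕ} {G : SimpleGraph (Fin n)} {ρ ρ' : Equiv.Perm (Fin n)} :
    graphicalModelTest G ρ ρ' ↔ ArgmaxLE (connectedSets G) (rankVec ρ) (rankVec ρ') :=
  mssTest_iff_argmaxLE connectedSets_nonempty

/-- If the highest rank in `[n] \ K` is at `i`, then the model contains `i ⫫ j | K` as soon as some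
permutation in the same class ranks `j` above `i`. -/
theorem mem_graphicalModel_of_lt {n : ℕ} {G : SimpleGraph (Fin n)} {ρ ρ' : Equiv.Perm (Fin n)}
    (h : graphicalModelTest G ρ ρ') {s : CIStatement n} (hK : ∀ x, x ∈ s.K ↔ ρ s.i < ρ x)
    (hlt : ρ' s.i < ρ' s.j) : s ∈ graphicalModel G := by
  rintro ⟨p, hp⟩
  -- A path avoiding `K` would be a connected set with its top rank at `i` under `ρ`, hence also
  -- under `ρ'`.
  have := graphicalModelTest_iff.1 h _ (support_mem_connectedSets p) s.i (by simp)
    (fun x hx => rankVec_le.2 (not_lt.1 fun hlt => hp x (List.mem_toFinset.1 hx) ((hK x).2 hlt)))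
    s.j (by simp)
  exact (rankVec_le.1 this).not_gt hlt

/-- Only the order of `i` and `j` changes at the wall, so a maximizer can change only on a connected
set with top `i` that contains `j`; such a set contains a path from `i` to `j` avoiding `s.K`. -/
theorem ShareWall.graphicalModelTest_iff {n : ℕ} {G : SimpleGraph (Fin n)}
    {ρ ρ' : Equiv.Perm (Fin n)} {s : CIStatement n} (h : ShareWall ρ ρ' s) :
    graphicalModelTest G ρ ρ' ↔ s ∈ graphicalModel G := by
  obtain ⟨h1, h2, h3⟩ := shareWall_iff.1 h
  constructor
  · intro hτ
    refine mem_graphicalModel_of_lt hτ h3 ?_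
    rw [h2, h2, Equiv.swap_apply_left, Equiv.swap_apply_right, Fin.lt_def]
    omega
  · intro hs
    refine RankTest.graphicalModelTest_iff.2 fun K hK k hk hmax x hx => ?_
    by_contra! hlt
    rcases (rankVec_le.1 (hmax x hx)).lt_or_eq with hxk | hxk
    · obtain ⟨rfl, rfl⟩ := h.eq_of_lt_of_gt hxk (rankVec_lt.1 hlt)
      obtain ⟨p, hp⟩ := exists_walk_of_mem_connectedSets hK hk hx
      exact hs ⟨p, fun y hy hyK =>
        (rankVec_le.1 (hmax y (hp y hy))).not_gt ((h3 y).1 hyK)⟩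
    · rw [ρ.injective hxk] at hlt
      exact lt_irrefl _ hlt

theorem removedWalls_graphicalModelTest {n : ℕ} (G : SimpleGraph (Fin n)) :
    removedWalls (graphicalModelTest G) = graphicalModel G := by
  ext s
  constructor
  · rintro ⟨ρ, ρ', hw, h⟩
    exact hw.graphicalModelTest_iff.1 h
  · intro hs
    obtain ⟨ρ, ρ', hw⟩ := exists_shareWall s
    exact ⟨ρ, ρ', hw, hw.graphicalModelTest_iff.2 hs⟩

/-! ### The classes of the graphical model rank test are connected by walls -/

/-- Two different permutations differ in the order of two positions that are adjacent in one. -/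
theorem exists_adjacent_inversion {n : ℕ} {ρ ρ' : Equiv.Perm (Fin n)} (h : ρ ≠ ρ') :
    ∃ i j, (ρ i : ℕ) = ρ j + 1 ∧ ρ' i < ρ' j := by
  by_contra! hle
  refine h (Equiv.ext fun x => ?_)
  rcases n with - | n
  · exact x.elim0
  -- If `ρ'` agrees with `ρ` on all consecutive ranks, then `ρ' ∘ ρ⁻¹` is a strictly increasing
  -- bijection of a finite chain, hence the identity.
  have hmono : StrictMono (ρ.symm.trans ρ') := by
    refine Fin.strictMono_iff_lt_succ.2 fun k => lt_of_le_of_ne ?_ ?_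
    · exact hle _ _ (by simp)
    · exact (ρ.symm.trans ρ').injective.ne k.castSucc_lt_succ.ne
  have := congrFun (StrictMono.range_inj hmono strictMono_id |>.1 (by simp)) (ρ x)
  simpa using this.symm

/-- The inversions of one permutation with respect to another one. -/
def inversions {n : ℕ} (ρ ρ' : Equiv.Perm (Fin n)) : Finset (Fin n × Fin n) :=
  Finset.univ.filter fun p => ρ p.1 < ρ p.2 ∧ ρ' p.2 < ρ' p.1

/-- Bubble sort: exchange two consecutive ranks that `ρ'` orders the other way. By
`mem_graphicalModel_of_lt` the wall crossed has its label in the model, so the class is unchanged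
while the number of inversions drops. -/
theorem testOfModel_of_graphicalModelTest {n : ℕ} {G : SimpleGraph (Fin n)}
    {ρ ρ' : Equiv.Perm (Fin n)} (h : graphicalModelTest G ρ ρ') :
    testOfModel (graphicalModel G) ρ ρ' := by
  classical
  induction hk : (inversions ρ ρ').card using Nat.strong_induction_on generalizing ρ with
  | _ k ih =>
    by_cases heq : ρ = ρ'
    · exact heq ▸ Setoid.refl' _ _
    obtain ⟨i, j, hij, hlt⟩ := exists_adjacent_inversion heq
    let s : CIStatement n :=
      { i := i
        j := j
        K := Finset.univ.filter fun x => ρ i < ρ x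
        ne := by rintro rfl; omega
        i_notMem := by simp
        j_notMem := by
          simp only [Finset.mem_filter_univ, Fin.lt_def]
          omega }
    have hs : s ∈ graphicalModel G := mem_graphicalModel_of_lt h (by simp [s]) hlt
    have hw : ShareWall ρ ((Equiv.swap i j).trans ρ) s :=
      shareWall_iff.2 ⟨hij, fun x => rfl, by simp [s]⟩
    refine Setoid.trans' _ (.rel _ _ ⟨s, hs, hw⟩) (ih _ ?_
      (Setoid.trans' _ (Setoid.symm' _ (hw.graphicalModelTest_iff.2 hs)) h) rfl)
    rw [← hk]
    refine Finset.card_lt_card (Finset.ssubset_iff_of_subset (fun p hp => ?_) |>.2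
      ⟨(j, i), ?_, ?_⟩)
    · simp only [inversions, Finset.mem_filter_univ] at hp ⊢
      refine ⟨?_, hp.2⟩
      rcases lt_trichotomy (ρ p.1) (ρ p.2) with hp' | hp' | hp'
      · exact hp'
      · rw [ρ.injective hp'] at hp
        exact absurd hp.1 (lt_irrefl _)
      · obtain ⟨h1, h2⟩ := hw.eq_of_lt_of_gt hp' hp.1
        rw [h1, h2] at hp
        exact absurd hp.2 hlt.not_gt
    · simp only [inversions, Finset.mem_filter_univ, Fin.lt_def] at hlt ⊢
      omega
    · simp only [inversions, Finset.mem_filter_univ, Equiv.trans_apply, Equiv.swap_apply_left,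
        Equiv.swap_apply_right, Fin.lt_def]
      omega

theorem graphicalModelTest_eq_testOfModel {n : ℕ} (G : SimpleGraph (Fin n)) :
    graphicalModelTest G = testOfModel (graphicalModel G) :=
  le_antisymm (fun _ _ => testOfModel_of_graphicalModelTest)
    (Setoid.eqvGen_le fun _ _ ⟨_, hs, hw⟩ => hw.graphicalModelTest_iff.2 hs)

/-- Reversal carries the graphical tubing rank test to the graphical model rank test. -/
theorem graphicalTubingTest_eq_comap {n : ℕ} (G : SimpleGraph (Fin n)) :
    graphicalTubingTest G = (graphicalModelTest G).comap reverse := by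
  rw [graphicalModelTest_eq_testOfModel]
  ext ρ ρ'
  constructor
  · exact testOfModel_of_reverse fun s hs => flip_mem_graphicalModel.2 (mem_dualModel.1 hs)
  · intro h
    have := testOfModel_of_reverse (N := dualModel (graphicalModel G)) (fun s hs => ?_) h
    · rwa [reverse_reverse, reverse_reverse] at this
    · rw [mem_dualModel, ← CIStatement.flip_star, CIStatement.star_star]
      exact flip_mem_graphicalModel.2 hs

theorem removedWalls_graphicalTubingTest {n : ℕ} (G : SimpleGraph (Fin n)) :
    removedWalls (graphicalTubingTest G) = dualModel (graphicalModel G) := by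
  rw [graphicalTubingTest_eq_comap, removedWalls_comap_reverse, removedWalls_graphicalModelTest]
  ext s
  rw [mem_dualModel, Set.mem_ofPred_eq, flip_mem_graphicalModel]

/-! ### Tubings and the cones of the normal fan -/

theorem insert_mem_connectedSets {n : ℕ} {G : SimpleGraph (Fin n)} {A : Finset (Fin n)}
    (hA : A ∈ connectedSets G) {a b : Fin n} (ha : a ∈ A) (hab : G.Adj a b) :
    insert b A ∈ connectedSets G := by
  rw [mem_connectedSets] at hA ⊢
  have := SimpleGraph.connected_induce_union hA.preconnected
    (SimpleGraph.induce_pair_connected_of_adj hab).preconnected ha (Set.mem_insert_of_mem a rfl) hab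
  have heq : ((insert b A : Finset (Fin n)) : Set (Fin n)) = (A : Set (Fin n)) ∪ {a, b} := by
    ext x
    simp only [Finset.coe_insert, Set.mem_insert_iff, Finset.mem_coe, Set.mem_union,
      Set.mem_singleton_iff]
    constructor
    · tauto
    · rintro (h | rfl | h)
      exacts [.inr h, .inr ha, .inl h]
  rwa [heq]

theorem isTube_iff {n : ℕ} {G : SimpleGraph (Fin n)} {A : Finset (Fin n)} :
    IsTube G A ↔ A ∈ connectedSets G ∧ ∃ a ∈ A, ∃ b ∉ A, G.Adj a b := by
  rw [IsTube, ← mem_connectedSets]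
  refine and_congr_right fun hA => ⟨fun h => ?_, ?_⟩
  · by_contra! hadj
    obtain ⟨a, ha⟩ := connectedSets_nonempty A hA
    refine h (G.connectedComponentMk a) (Set.ext fun x => ⟨fun hx => ?_, fun hx => ?_⟩)
    · obtain ⟨p, -⟩ := exists_walk_of_mem_connectedSets hA hx ha
      exact SimpleGraph.ConnectedComponent.sound ⟨p⟩
    · obtain ⟨p⟩ := SimpleGraph.ConnectedComponent.exact hx
      by_contra hxA
      obtain ⟨d, -, h1, h2⟩ := p.reverse.exists_boundary_dart (A : Set (Fin n)) ha hxA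
      exact hadj _ h1 _ h2 d.adj
  · rintro ⟨a, ha, b, hb, hab⟩ c hc
    have ha' : a ∈ c.supp := hc ▸ ha
    have : b ∈ c.supp := c.mem_supp_of_adj_mem_supp ha' hab
    rw [← hc] at this
    exact hb this

open Classical in
/-- The tubes on which `u` is smaller than at all neighbours outside. -/
noncomputable def sublevelTubes {n : ℕ} (G : SimpleGraph (Fin n)) (u : Fin n → ℝ) :
    Finset (Finset (Fin n)) :=
  Finset.univ.filter fun A => IsTube G A ∧
    ∀ a ∈ A, ∀ b ∉ A, G.Adj a b → ∀ x ∈ A, u x < u b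

theorem mem_sublevelTubes {n : ℕ} {G : SimpleGraph (Fin n)} {u : Fin n → ℝ}
    {A : Finset (Fin n)} : A ∈ sublevelTubes G u ↔
      IsTube G A ∧ ∀ a ∈ A, ∀ b ∉ A, G.Adj a b → ∀ x ∈ A, u x < u b := by
  simp [sublevelTubes]

theorem isTubing_sublevelTubes {n : ℕ} (G : SimpleGraph (Fin n)) (u : Fin n → ℝ) :
    IsTubing G (sublevelTubes G u) := by
  refine ⟨fun A hA => (mem_sublevelTubes.1 hA).1, ?_⟩
  -- If `u` on `A` never exceeds its value at `m ∈ B`, no edge leads from `B` to a vertex of `A`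
  -- outside `B`. Connectedness then puts `A` inside `B` or apart from it.
  have key : ∀ A ∈ sublevelTubes G u, ∀ B ∈ sublevelTubes G u, ∀ m ∈ B, (∀ x ∈ A, u x ≤ u m) →
      A ⊆ B ∨ Disjoint A B ∧ ∀ a ∈ A, ∀ b ∈ B, ¬ G.Adj a b := by
    intro A hA B hB m hm hmax
    obtain ⟨hAt, -⟩ := mem_sublevelTubes.1 hA
    obtain ⟨-, hBu⟩ := mem_sublevelTubes.1 hB
    have hno : ∀ b ∈ B, ∀ a ∈ A, a ∉ B → ¬ G.Adj b a := fun b hb a ha haB hab =>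
      (hBu b hb a haB hab m hm).not_ge (hmax a ha)
    by_cases hAB : A ⊆ B
    · exact .inl hAB
    · obtain ⟨y, hyA, hyB⟩ := Finset.not_subset.1 hAB
      have hdisj : Disjoint A B := by
        refine Finset.disjoint_left.2 fun x hxA hxB => ?_
        obtain ⟨a, ha, b, hb, haB, hbB, hab⟩ :=
          exists_adj_of_mem_connectedSets (isTube_iff.1 hAt).1 B hxA hyA hxB hyB
        exact hno a haB b hb hbB hab
      exact .inr ⟨hdisj, fun a ha b hb hab =>
        hno b hb a ha (Finset.disjoint_left.1 hdisj ha) hab.symm⟩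
  intro A hA B hB
  obtain ⟨a, ha, hamax⟩ := Finset.exists_max_image A u
    (connectedSets_nonempty A (isTube_iff.1 (mem_sublevelTubes.1 hA).1).1)
  obtain ⟨b, hb, hbmax⟩ := Finset.exists_max_image B u
    (connectedSets_nonempty B (isTube_iff.1 (mem_sublevelTubes.1 hB).1).1)
  rcases le_total (u a) (u b) with hab | hab
  · rcases key A hA B hB b hb (fun x hx => (hamax x hx).trans hab) with h | h
    exacts [.inl h, .inr (.inr h)]
  · rcases key B hB A hA a ha (fun x hx => (hbmax x hx).trans hab) with h | h
    exacts [.inr (.inl h), .inr (.inr ⟨h.1.symm, fun x hx y hy hxy => h.2 y hy x hx hxy.symm⟩)]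

/-- The order of the normal cones in terms of tubings. -/
theorem argmaxLE_iff_sublevelTubes_subset {n : ℕ} {G : SimpleGraph (Fin n)} {u v : Fin n → ℝ} :
    ArgmaxLE (connectedSets G) u v ↔ sublevelTubes G v ⊆ sublevelTubes G u := by
  classical
  constructor
  · intro h A hA
    obtain ⟨hAt, hAv⟩ := mem_sublevelTubes.1 hA
    refine mem_sublevelTubes.2 ⟨hAt, fun a ha b hb hab x hx => ?_⟩
    -- The connected set `A ∪ {b}` tests the tube: under `v`, and hence under `u`, no vertex of `A`
    -- is maximal on it.
    have hK := insert_mem_connectedSets (isTube_iff.1 hAt).1 ha hab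
    obtain ⟨m, hm, hmax⟩ := Finset.exists_max_image (insert b A) u ⟨b, Finset.mem_insert_self b A⟩
    have hnot : ∀ y ∈ A, ¬ ∀ j ∈ insert b A, u j ≤ u y := fun y hy hymax =>
      (hAv a ha b hb hab y hy).not_ge
        (h _ hK y (Finset.mem_insert_of_mem hy) hymax b (Finset.mem_insert_self b A))
    have hmb : m = b := (Finset.mem_insert.1 hm).resolve_right fun hmA => hnot m hmA hmax
    subst hmb
    refine lt_of_not_ge fun hle => hnot x hx fun j hj => (hmax j hj).trans hle
  · intro h K hK k hk hmax j hj
    by_contra! hlt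
    -- A maximal connected set through `k` in the sublevel set `v ≤ v k`. It is a sublevel tube of
    -- `v`, as `K` leaves it towards `j`, so it is one of `u`; the exit vertex in `K` then
    -- contradicts the `u`-maximality of `k`.
    obtain ⟨A, hA⟩ := Finset.exists_maximal (s := (connectedSets G).filter
      fun A => k ∈ A ∧ ∀ x ∈ A, v x ≤ v k) ⟨{k}, by
        simpa using support_mem_connectedSets (G := G) (.nil : G.Walk k k)⟩
    obtain ⟨hAc, hkA, hAk⟩ := Finset.mem_filter.1 hA.1
    have hbd : ∀ a ∈ A, ∀ b ∉ A, G.Adj a b → v k < v b := by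
      intro a ha b hb hab
      by_contra! hle
      have := hA.2 (Finset.mem_filter.2 ⟨insert_mem_connectedSets hAc ha hab,
        Finset.mem_insert_of_mem hkA, fun x hx => ?_⟩) (Finset.subset_insert b A)
      · exact hb (this (Finset.mem_insert_self b A))
      · rcases Finset.mem_insert.1 hx with rfl | hx
        exacts [hle, hAk x hx]
    obtain ⟨a, haK, b, hbK, ha, hb, hab⟩ := exists_adj_of_mem_connectedSets hK A hk hj hkA
      (fun hjA => (hAk j hjA).not_gt hlt)
    have hAt : A ∈ sublevelTubes G v := mem_sublevelTubes.2
      ⟨isTube_iff.2 ⟨hAc, a, ha, b, hb, hab⟩, fun a' ha' b' hb' hab' x hx =>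
        (hAk x hx).trans_lt (hbd a' ha' b' hb' hab')⟩
    exact ((mem_sublevelTubes.1 (h hAt)).2 a ha b hb hab k hkA).not_ge (hmax b hbK)

open Classical in
/-- The vector whose coordinates are the negated numbers of tubes at the vertices. -/
noncomputable def tubingVector {n : ℕ} (T : Finset (Finset (Fin n))) : Fin n → ℝ :=
  fun x => -((T.filter fun A => x ∈ A).card : ℝ)

theorem tubingVector_lt {n : ℕ} {T : Finset (Finset (Fin n))} {x y : Fin n}
    (h : ∀ B ∈ T, y ∈ B → x ∈ B) {A : Finset (Fin n)} (hA : A ∈ T) (hx : x ∈ A) (hy : y ∉ A) :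
    tubingVector T x < tubingVector T y := by
  classical
  refine neg_lt_neg (Nat.cast_lt.2 (Finset.card_lt_card ?_))
  refine (Finset.ssubset_iff_of_subset fun B hB => ?_).2 ⟨A, ?_, ?_⟩
  · rw [Finset.mem_filter] at hB ⊢
    exact ⟨hB.1, h B hB.1 hB.2⟩
  · exact Finset.mem_filter.2 ⟨hA, hx⟩
  · exact fun h => hy (Finset.mem_filter.1 h).2

theorem exists_of_tubingVector_lt {n : ℕ} {T : Finset (Finset (Fin n))} {x y : Fin n}
    (h : tubingVector T x < tubingVector T y) : ∃ B ∈ T, x ∈ B ∧ y ∉ B := by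
  classical
  by_contra! hle
  refine h.not_ge (neg_le_neg (Nat.cast_le.2 (Finset.card_le_card fun B hB => ?_)))
  rw [Finset.mem_filter] at hB ⊢
  exact ⟨hB.1, hle B hB.1 hB.2⟩

/-- Smaller values mean more tubes. At an edge leaving a tube `A` of `T`, every tube containing the
outer end must contain `A`, so the value is strictly larger outside. Conversely, a sublevel tube is
the smallest tube of `T` around its vertex of largest value. -/
theorem sublevelTubes_tubingVector {n : ℕ} {G : SimpleGraph (Fin n)}
    {T : Finset (Finset (Fin n))} (hT : IsTubing G T) :
    sublevelTubes G (tubingVector T) = T := by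
  classical
  have hsub : T ⊆ sublevelTubes G (tubingVector T) := by
    intro A hA
    refine mem_sublevelTubes.2 ⟨hT.1 A hA, fun a ha b hb hab x hx =>
      tubingVector_lt (fun B hB hbB => ?_) hA hx hb⟩
    rcases hT.2 A hA B hB with h | h | h
    · exact h hx
    · exact absurd (h hbB) hb
    · exact absurd hab (h.2 a ha b hbB)
  refine (Finset.Subset.antisymm hsub fun A hA => ?_).symm
  obtain ⟨hAt, hAu⟩ := mem_sublevelTubes.1 hA
  obtain ⟨hAc, a, ha, b, hb, hab⟩ := isTube_iff.1 hAt
  obtain ⟨k, hk, hmax⟩ := Finset.exists_max_image A (tubingVector T) ⟨a, ha⟩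
  -- A tube around `k` not containing `A` would have an outer neighbour in `A` with a value larger
  -- than at `k`.
  have hsup : ∀ B ∈ T, k ∈ B → A ⊆ B := by
    intro B hB hkB
    by_contra hAB
    obtain ⟨y, hyA, hyB⟩ := Finset.not_subset.1 hAB
    obtain ⟨c, -, d, hdA, hc, hd, hcd⟩ := exists_adj_of_mem_connectedSets hAc B hk hyA hkB hyB
    exact ((mem_sublevelTubes.1 (hsub hB)).2 c hc d hd hcd k hkB).not_ge (hmax d hdA)
  obtain ⟨B₀, hB₀, hkB₀, -⟩ := exists_of_tubingVector_lt (hAu a ha b hb hab k hk)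
  -- By compatibility, this minimal tube around `k` is the least one. If it exceeded `A`, an edge
  -- leaving `A` within it would reach a vertex missed by some tube of `T` around `k`.
  obtain ⟨B, hB⟩ := Finset.exists_minimal (s := T.filter fun B => k ∈ B)
    ⟨B₀, Finset.mem_filter.2 ⟨hB₀, hkB₀⟩⟩
  obtain ⟨hBT, hkB⟩ := Finset.mem_filter.1 hB.1
  have hBmin : ∀ C ∈ T, k ∈ C → B ⊆ C := by
    intro C hC hkC
    rcases hT.2 B hBT C hC with h | h | h
    · exact h
    · exact hB.2 (Finset.mem_filter.2 ⟨hC, hkC⟩) h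
    · exact absurd hkC (Finset.disjoint_left.1 h.1 hkB)
  suffices A = B from this ▸ hBT
  refine (hsup B hBT hkB).antisymm ?_
  by_contra hBA
  obtain ⟨y, hyB, hyA⟩ := Finset.not_subset.1 hBA
  obtain ⟨c, -, d, hdB, hc, hd, hcd⟩ :=
    exists_adj_of_mem_connectedSets (isTube_iff.1 (hT.1 B hBT)).1 A hkB hyB hk hyA
  obtain ⟨C, hC, hkC, hdC⟩ := exists_of_tubingVector_lt (hAu c hc d hd hcd k hk)
  exact hdC (hBmin C hC hkC hdB)

theorem normalCone_le_normalCone_iff {n : ℕ} {𝒦 : Finset (Finset (Fin n))}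
    (h𝒦 : ∀ K ∈ 𝒦, K.Nonempty) {u w : Fin n → ℝ} :
    normalCone (mssPolytope 𝒦) (maxFace (mssPolytope 𝒦) u) ≤
      normalCone (mssPolytope 𝒦) (maxFace (mssPolytope 𝒦) w) ↔ ArgmaxLE 𝒦 w u := by
  constructor
  · exact fun h => (mem_normalCone_maxFace h𝒦).1 (h ((mem_normalCone_maxFace h𝒦).2 (.refl u)))
  · exact fun h v hv => (mem_normalCone_maxFace h𝒦).2 (h.trans ((mem_normalCone_maxFace h𝒦).1 hv))

/-- The face poset of the tubing complex embeds into the normal fan of the graph associahedron. -/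
noncomputable def tubingCone {n : ℕ} (G : SimpleGraph (Fin n)) :
    TubingComplex G ↪o
      {C : PointedCone ℝ (Fin n → ℝ) // C ∈ normalFan (graphAssociahedron G)} :=
  OrderEmbedding.ofMapLEIff
    (fun T => ⟨_, normalCone_maxFace_mem_normalFan connectedSets_nonempty (tubingVector T.1)⟩)
    fun S T => by
      rw [← Subtype.coe_le_coe, normalCone_le_normalCone_iff connectedSets_nonempty,
        argmaxLE_iff_sublevelTubes_subset, sublevelTubes_tubingVector S.2,
        sublevelTubes_tubingVector T.2]
      rfl

theorem tubingCone_surjective {n : ℕ} (G : SimpleGraph (Fin n)) :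
    Function.Surjective (tubingCone G) := by
  rintro ⟨C, u, -, rfl⟩
  have h := sublevelTubes_tubingVector (isTubing_sublevelTubes G u)
  refine ⟨⟨sublevelTubes G u, isTubing_sublevelTubes G u⟩, Subtype.ext (le_antisymm ?_ ?_)⟩
  · refine (normalCone_le_normalCone_iff connectedSets_nonempty).2
      (argmaxLE_iff_sublevelTubes_subset.2 h.le)
  · refine (normalCone_le_normalCone_iff connectedSets_nonempty).2
      (argmaxLE_iff_sublevelTubes_subset.2 h.ge)

end RankTest

/-! ### Assembly of the isomorphisms -/

theorem theorem5p3 {n : ℕ} (G : SimpleGraph (Fin n)) :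
    -- the graphical model rank test is (the rank test of) the normal fan of `Δ_G`
    (∀ F : Set (PointedCone ℝ (Fin n → ℝ)),
      RankTest.IsFanOf F (RankTest.graphicalModelTest G) ↔
        F = RankTest.normalFan (RankTest.graphAssociahedron G)) ∧
    -- the graphical tubing rank test is the image of this fan under `u ↦ -u`
    (∀ F : Set (PointedCone ℝ (Fin n → ℝ)),
      RankTest.IsFanOf F (RankTest.graphicalTubingTest G) ↔
        F = RankTest.oppositeFan (RankTest.normalFan (RankTest.graphAssociahedron G))) ∧
    -- on permutations, reversal is an isomorphism between the two rank tests
    (∀ ρ ρ' : Equiv.Perm (Fin n),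
      RankTest.graphicalTubingTest G ρ ρ' ↔
        RankTest.graphicalModelTest G (RankTest.reverse ρ) (RankTest.reverse ρ')) ∧
    -- the semigraphoids of the two rank tests are the graphical model and its dual
    RankTest.removedWalls (RankTest.graphicalModelTest G) = RankTest.graphicalModel G ∧
    RankTest.removedWalls (RankTest.graphicalTubingTest G) =
      RankTest.dualModel (RankTest.graphicalModel G) ∧
    -- the face poset of the fan is that of the simplicial complex of tubings
    Nonempty
      (RankTest.TubingComplex G ≃o
        {C : PointedCone ℝ (Fin n → ℝ) //
          C ∈ RankTest.normalFan (RankTest.graphAssociahedron G)}) := by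
  have hfan : RankTest.IsFanOf (RankTest.normalFan (RankTest.graphAssociahedron G))
      (RankTest.graphicalModelTest G) :=
    RankTest.isFanOf_mssTest RankTest.connectedSets_nonempty
  have hop := hfan.oppositeFan
  rw [← RankTest.graphicalTubingTest_eq_comap] at hop
  refine ⟨fun F => ⟨fun h => h.unique hfan, fun h => h ▸ hfan⟩,
    fun F => ⟨fun h => h.unique hop, fun h => h ▸ hop⟩, fun ρ ρ' => ?_,
    RankTest.removedWalls_graphicalModelTest G, RankTest.removedWalls_graphicalTubingTest G,
    ⟨RelIso.ofSurjective (RankTest.tubingCone G) (RankTest.tubingCone_surjective G)⟩⟩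
  rw [RankTest.graphicalTubingTest_eq_comap, Setoid.comap_rel]
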